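/- Let $k,d\in\mathbb N$ and let $M\in C^2(\mathbb R^k,M_d(\mathbb R))$ be such that $M(x)$ is skew-symmetric for every $x$. Let $\mathbf P$ be the closure in $L^2(\mathbb R^k,\mathbb R^d)$, under the graph norm, of the operator $-\Delta\otimes I_d+M(x)$ defined on $C_0^\infty(\mathbb R^k,\mathbb R^d)$, and let $D(\mathbf P)$ be its domain. Set $$\mathcal S(x)=\inf_{\lambda\in\sigma(M(x))\setminus\{0\}}|\lambda|,$$ where $\sigma(M(x))\subset\mathbb C$ is the set of complex eigenvalues of $M(x)$ and $\inf\emptyset=+\infty$. (1) Suppose that there exist $C>0$ and $R>0$ such that, for all $|x|\ge R$, $$|\partial_x^\alpha M_{i,j}(x)|\le C\,\mathcal S(x)\qquad\text{for all } i,j=1,\dots,d \text{ and all } \alpha \text{ with } 1\le|\alpha|\le 2,$$ and that $\dim\operatorname{Ker}M(x)$ is constant on $\{|x|\ge R\}$. Then $-\Delta\otimes I_d+M$ on $C_0^\infty(\mathbb R^k,\mathbb R^d)$ is closable and $$D(\mathbf P)=\{\mathbf u\in H^2(\mathbb R^k,\mathbb R^d)\;:\;M\mathbf u\in L^2(\mathbb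 R^k,\mathbb R^d)\}.$$ (2) Let $d=k=3$ and $M(x)\mathbf u=\mathbf b(x)\times\mathbf u$ with $\mathbf b\in C^2(\mathbb R^3,\mathbb R^3)$. Suppose that there exist $C>0$ and $R>0$ such that, for all $|x|\ge R$, $\mathbf b(x)\ne0$ and $$|\partial_x^\alpha b_j(x)|\le C\,|\mathbf b(x)|\qquad\text{for } j=1,2,3 \text{ and all } \alpha \text{ with } 1\le|\alpha|\le2.$$ Then $-\Delta\otimes I_3+M$ on $C_0^\infty(\mathbb R^3,\mathbb R^3)$ is closable and $$D(\mathbf P)=\{\mathbf u\in H^2(\mathbb R^3,\mathbb R^3)\;:\;\mathbf b\times\mathbf u\in L^2(\mathbb R^3,\mathbb R^3)\}.$$ -/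

import Mathlib

open MeasureTheory Matrix Laplacian
open scoped ENNReal ContDiff

noncomputable section

/-- The partial derivative `∂_{a 0} ⋯ ∂_{a (n-1)} f (x)` of order `n`. As `a` runs over all functions
`Fin n → Fin k`, these are the derivatives `∂^α f (x)` with `|α| = n`. -/
def partialDeriv {k n : ℕ} (a : Fin n → Fin k) (f : EuclideanSpace ℝ (Fin k) → ℝ)
    (x : EuclideanSpace ℝ (Fin k)) : ℝ :=
  iteratedFDeriv ℝ n f x (fun l => EuclideanSpace.single (a l) (1 : ℝ))

/-- `inf {|λ| : λ ∈ σ(A), λ ≠ 0}`, where `σ(A) ⊆ ℂ` is the set of complex eigenvalues of the real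
matrix `A`. The infimum of the empty set is `∞`. -/
def minNonzeroEigenvalueModulus {d : ℕ} (A : Matrix (Fin d) (Fin d) ℝ) : ℝ≥0∞ :=
  ⨅ z ∈ spectrum ℂ (A.map (algebraMap ℝ ℂ)) \ {0}, ‖z‖ₑ

/-- `dim Ker A`. -/
def dimKer {d : ℕ} (A : Matrix (Fin d) (Fin d) ℝ) : ℕ :=
  Module.finrank ℝ (LinearMap.ker (Matrix.toLin' A))

/-- The function `x ↦ M(x) u(x)`. -/
def mulField {k d : ℕ} (M : EuclideanSpace ℝ (Fin k) → Matrix (Fin d) (Fin d) ℝ)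
    (u : EuclideanSpace ℝ (Fin k) → EuclideanSpace ℝ (Fin d)) :
    EuclideanSpace ℝ (Fin k) → EuclideanSpace ℝ (Fin d) :=
  fun x => WithLp.toLp 2 (M x *ᵥ (u x).ofLp)

/-- `L²(ℝᵏ, ℝᵈ)`. -/
abbrev L2Field (k d : ℕ) : Type :=
  Lp (EuclideanSpace ℝ (Fin d)) 2 (volume : Measure (EuclideanSpace ℝ (Fin k)))

/-- `v` is the weak derivative `∂_a u` on `ℝᵏ`. -/
def IsWeakPartialDeriv {k d : ℕ} (a : Fin k)
    (u v : EuclideanSpace ℝ (Fin k) → EuclideanSpace ℝ (Fin d)) : Prop :=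
  ∀ φ : EuclideanSpace ℝ (Fin k) → ℝ, ContDiff ℝ ∞ φ → HasCompactSupport φ →
    ∫ x, (fderiv ℝ φ x (EuclideanSpace.single a (1 : ℝ))) • u x = - ∫ x, φ x • v x

/-- `u ∈ H²(ℝᵏ, ℝᵈ)`: `u` and its weak derivatives of first and second order are in `L²`. -/
def MemH2 {k d : ℕ} (u : EuclideanSpace ℝ (Fin k) → EuclideanSpace ℝ (Fin d)) : Prop :=
  MemLp u 2 ∧
  ∃ (v : Fin k → EuclideanSpace ℝ (Fin k) → EuclideanSpace ℝ (Fin d))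
    (w : Fin k → Fin k → EuclideanSpace ℝ (Fin k) → EuclideanSpace ℝ (Fin d)),
    (∀ a, MemLp (v a) 2 ∧ IsWeakPartialDeriv a u (v a)) ∧
    (∀ a b, MemLp (w a b) 2 ∧ IsWeakPartialDeriv b (v a) (w a b))

/-- The set of pairs `(φ, -Δφ + Mφ)` in `L² × L²` with `φ ∈ C₀^∞(ℝᵏ, ℝᵈ)`. -/
def schrodingerGraph {k d : ℕ} (M : EuclideanSpace ℝ (Fin k) → Matrix (Fin d) (Fin d) ℝ) :
    Submodule ℝ (L2Field k d × L2Field k d) where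
  carrier := {p | ∃ φ : EuclideanSpace ℝ (Fin k) → EuclideanSpace ℝ (Fin d),
    ContDiff ℝ ∞ φ ∧ HasCompactSupport φ ∧
    p.1 =ᵐ[volume] φ ∧ p.2 =ᵐ[volume] fun x => -(Δ φ) x + mulField M φ x}
  zero_mem' := by
    refine ⟨0, contDiff_const, HasCompactSupport.zero, Lp.coeFn_zero _ _ _, ?_⟩
    filter_upwards [Lp.coeFn_zero (EuclideanSpace ℝ (Fin d)) 2
      (volume : Measure (EuclideanSpace ℝ (Fin k)))] with x hx
    have h0 : (Δ (0 : EuclideanSpace ℝ (Fin k) → EuclideanSpace ℝ (Fin d))) x = 0 := by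
      have h := InnerProductSpace.laplacian_smul (0 : ℝ)
        (f := (0 : EuclideanSpace ℝ (Fin k) → EuclideanSpace ℝ (Fin d))) (x := x)
        contDiffAt_const
      simpa using h
    rw [h0]
    simp [mulField]
  add_mem' := by
    rintro p q ⟨φ, hφ, hφc, h1, h2⟩ ⟨ψ, hψ, hψc, h3, h4⟩
    refine ⟨φ + ψ, hφ.add hψ, hφc.add hψc, ?_, ?_⟩
    · filter_upwards [Lp.coeFn_add p.1 q.1, h1, h3] with x hx h1 h3
      rw [Prod.fst_add, hx, Pi.add_apply, Pi.add_apply, h1, h3]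
    · filter_upwards [Lp.coeFn_add p.2 q.2, h2, h4] with x hx h2 h4
      have h := ContDiffAt.laplacian_add (x := x)
        (hφ.contDiffAt.of_le (by norm_cast))
        (hψ.contDiffAt.of_le (by norm_cast))
      simp only [Prod.snd_add, hx, Pi.add_apply, h2, h4, h, mulField, WithLp.ofLp_add,
        Matrix.mulVec_add, WithLp.toLp_add]
      abel
  smul_mem' := by
    rintro c p ⟨φ, hφ, hφc, h1, h2⟩
    refine ⟨c • φ, contDiff_const.smul hφ, hφc.smul_left (f := fun _ => c), ?_, ?_⟩
    · filter_upwards [Lp.coeFn_smul c p.1, h1] with x hx h1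
      rw [Prod.smul_fst, hx, Pi.smul_apply, Pi.smul_apply, h1]
    · filter_upwards [Lp.coeFn_smul c p.2, h2] with x hx h2
      have h := InnerProductSpace.laplacian_smul (x := x) c
        (hφ.contDiffAt.of_le (by norm_cast))
      simp only [Prod.smul_snd, hx, Pi.smul_apply, h2, h, mulField, WithLp.ofLp_smul,
        Matrix.mulVec_smul, WithLp.toLp_smul, smul_add, smul_neg]

/-- The operator `-Δ ⊗ I_d + M` in `L²(ℝᵏ, ℝᵈ)` with domain `C₀^∞(ℝᵏ, ℝᵈ)`. -/
def schrodingerOp {k d : ℕ} (M : EuclideanSpace ℝ (Fin k) → Matrix (Fin d) (Fin d) ℝ) :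
    L2Field k d →ₗ.[ℝ] L2Field k d :=
  (schrodingerGraph M).toLinearPMap

/-- The set of pairs `(φ, -Δφ + Mφ)` is the graph of an operator, namely of `schrodingerOp M`. -/
theorem schrodingerOp_graph {k d : ℕ}
    (M : EuclideanSpace ℝ (Fin k) → Matrix (Fin d) (Fin d) ℝ) :
    (schrodingerOp M).graph = schrodingerGraph M := by
  refine Submodule.toLinearPMap_graph_eq _ ?_
  rintro p ⟨φ, hφ, -, h1, h2⟩ hp
  have hφ0 : φ = 0 := by
    refine (Continuous.ae_eq_iff_eq (volume : Measure (EuclideanSpace ℝ (Fin k)))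
      hφ.continuous continuous_const).1 ?_
    rw [hp] at h1
    exact h1.symm.trans (Lp.coeFn_zero _ _ _)
  obtain ⟨ψ, hψ, -, h3, h4⟩ := (schrodingerGraph M).zero_mem
  have hψ0 : ψ = 0 := by
    refine (Continuous.ae_eq_iff_eq (volume : Measure (EuclideanSpace ℝ (Fin k)))
      hψ.continuous continuous_const).1 ?_
    exact h3.symm.trans (Lp.coeFn_zero _ _ _)
  subst hφ0 hψ0
  exact Lp.ext (h2.trans h4.symm)

/-- The operator **P**: the closure, under the graph norm, of `-Δ ⊗ I_d + M` defined on
`C₀^∞(ℝᵏ, ℝᵈ)`. -/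
def closedSchrodingerOp {k d : ℕ}
    (M : EuclideanSpace ℝ (Fin k) → Matrix (Fin d) (Fin d) ℝ) :
    L2Field k d →ₗ.[ℝ] L2Field k d :=
  (schrodingerOp M).closure

/-- The `3 × 3` matrix of the linear map `v ↦ b × v`. -/
def crossMatrix (b : EuclideanSpace ℝ (Fin 3)) : Matrix (Fin 3) (Fin 3) ℝ :=
  LinearMap.toMatrix' (crossProduct b.ofLp)

theorem crossMatrix_mulVec (b : EuclideanSpace ℝ (Fin 3)) (v : Fin 3 → ℝ) :
    crossMatrix b *ᵥ v = b.ofLp ⨯₃ v := by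
  simp [crossMatrix, LinearMap.toMatrix'_mulVec]

end

/-! Everything rests on an a priori estimate for test functions (`exists_apriori_bound`): the first
and second derivatives of `u`, and `Mu`, are bounded in L² by `u` and `f = -Δu + Mu`. Skewness
removes `M` from the pairing of `u` with `f`, which bounds the gradient. Once `Mu` is bounded, so is
`Δu = Mu - f`, and integration by parts turns this into a bound for all second derivatives
(`integral_norm_sq_hessian`).

The bound on `Mu` is the substantial point (`integral_norm_sq_apply_le`). Let `Q` be the orthogonal
projection onto the range of `M`, multiplied by a cutoff vanishing on a large ball, and let `v =
Qu`. Pair `Δv` with `Mv` and integrate by parts. The term `⟨M ∂v, ∂v⟩` is zero by skewness, leaving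
`⟨(∂M)v, ∂v⟩`. On the range of `M` one has `|Mv| ≥ S|v|`, with `S` the smallest nonzero eigenvalue
modulus, so `|∂M| ≤ CS` gives `|(∂M)v| ≤ C'|Mv|`. Since `Q` commutes with `M`, `Δv` equals `Mv - Qf`
plus terms containing derivatives of `Q`. Thus the square of the L² norm of `Mv` is at most that
norm times controlled quantities, and it can be absorbed. Finally `Mu` and `Mv` differ only by a
bounded multiple of `u` on a bounded region.

This requires `Q` to be C² with bounded derivatives (`exists_cutoff_projection`). Constancy of the
kernel dimension makes the kernel projection a polynomial in `M` whose coefficients are C² in `x`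
(`coeff_smul_kerProj`). Its derivatives are bounded by differentiating `MP = 0` and `P² = P` and
dividing by `S` (`norm_deriv_kerProj_le`).

By the estimate, convergence in the graph norm forces L² convergence of the derivatives and of `Mu`
(`exists_of_mem_closure_graph`). Hence the closure of the graph is again a graph, and its domain
lies in the asserted space. Conversely, an `H²` function with `Mu` in L² is approximated by cutting
off and then mollifying (`mem_closure_of_memH2`); this half needs neither skewness nor the
derivative bounds. For the cross product, the eigenvalues are `0` and `±i|b|` and the kernel is the
line through `b`, so the second statement is a case of the first. -/

/-! ### Skew-adjoint operators on a finite-dimensional Euclidean space -/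

section SkewAdjoint

open ContinuousLinearMap Polynomial

variable {F : Type*} [NormedAddCommGroup F] [InnerProductSpace ℝ F] [FiniteDimensional ℝ F]

/-- The orthogonal projection onto the kernel of `A`. -/
noncomputable def kerProj (A : F →L[ℝ] F) : F →L[ℝ] F := A.ker.starProjection

theorem inner_skew {A : F →L[ℝ] F} (hA : adjoint A = -A) (v w : F) :
    inner ℝ (A v) w = -inner ℝ v (A w) := by
  rw [← adjoint_inner_right, hA]; simp

theorem inner_skew_self {A : F →L[ℝ] F} (hA : adjoint A = -A) (v : F) :
    inner ℝ v (A v) = 0 := by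
  have h := inner_skew hA v v
  rw [real_inner_comm] at h
  linarith

/-- A skew operator has no nilpotent part: if `A²y = 0`, then `|Ay|² = -⟨y, A²y⟩ = 0`. Powers are
therefore removed one at a time. -/
theorem apply_eq_zero_of_pow_apply_eq_zero {A : F →L[ℝ] F} (hA : adjoint A = -A) (n : ℕ) (w : F)
    (h : (A ^ n) w = 0) : A w = 0 := by
  induction n with
  | zero => simp_all
  | succ n ih =>
    rcases n with _ | n
    · simpa using h
    · apply ih
      have h1 : A (A ((A ^ n) w)) = 0 := by
        simpa [pow_succ'] using h
      have h2 : inner ℝ (A ((A ^ n) w)) (A ((A ^ n) w)) = 0 := by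
        rw [inner_skew hA, h1]; simp
      simpa [pow_succ'] using inner_self_eq_zero.1 h2

theorem apply_kerProj (A : F →L[ℝ] F) (w : F) : A (kerProj A w) = 0 := by
  have : kerProj A w ∈ A.ker := Submodule.starProjection_apply_mem _ _
  simpa using this

theorem mul_kerProj (A : F →L[ℝ] F) : A * kerProj A = 0 := by
  ext w; simp [apply_kerProj]

theorem star_kerProj (A : F →L[ℝ] F) : star (kerProj A) = kerProj A :=
  isSelfAdjoint_starProjection _

theorem kerProj_mul_kerProj (A : F →L[ℝ] F) : kerProj A * kerProj A = kerProj A :=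
  (isStarProjection_starProjection (U := A.ker)).isIdempotentElem

theorem norm_kerProj_le (A : F →L[ℝ] F) : ‖kerProj A‖ ≤ 1 := Submodule.starProjection_norm_le _

theorem kerProj_mul {A : F →L[ℝ] F} (hA : adjoint A = -A) : kerProj A * A = 0 := by
  have h := congrArg star (mul_kerProj A)
  rw [star_mul, star_kerProj, star_eq_adjoint A, hA] at h
  simpa using h

theorem kerProj_apply_of_apply_eq_zero {A : F →L[ℝ] F} {w : F} (h : A w = 0) :
    kerProj A w = w :=
  Submodule.starProjection_eq_self_iff.2 (by simpa using h)

/-- The complement of the kernel is the closure of the range of the adjoint `-A`, and in finite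
dimension that range is already closed. -/
theorem exists_eq_kerProj_add {A : F →L[ℝ] F} (hA : adjoint A = -A) (w : F) :
    ∃ y, w = kerProj A w + A y := by
  have h : w - kerProj A w ∈ A.kerᗮ := Submodule.sub_starProjection_mem_orthogonal _
  rw [ContinuousLinearMap.orthogonal_ker, hA, IsClosed.submodule_topologicalClosure_eq] at h
  · obtain ⟨y, hy⟩ := h
    refine ⟨-y, ?_⟩
    have : -(A y) = w - kerProj A w := by simpa using hy
    rw [map_neg, this]; abel
  · exact Submodule.closed_of_finiteDimensional _

/-- The multiplicity of the root `0` is the dimension of the generalized kernel, which for a skew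
operator is the kernel itself. -/
theorem finrank_ker_eq_natTrailingDegree_charpoly {A : F →L[ℝ] F} (hA : adjoint A = -A) :
    Module.finrank ℝ A.ker = (A : F →ₗ[ℝ] F).charpoly.natTrailingDegree := by
  rw [← LinearMap.finrank_maxGenEigenspace_zero_eq]
  suffices h : A.ker = Module.End.maxGenEigenspace (A : F →ₗ[ℝ] F) 0 by rw [h]
  apply le_antisymm
  · intro w hw
    rw [Module.End.mem_maxGenEigenspace]
    refine ⟨1, ?_⟩
    simpa using hw
  · intro w hw
    rw [Module.End.mem_maxGenEigenspace] at hw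
    obtain ⟨n, hn⟩ := hw
    have h : (A ^ n) w = 0 := by
      rw [zero_smul, sub_zero] at hn
      rw [← hn, ← ContinuousLinearMap.coe_coe, ContinuousLinearMap.toLinearMap_pow]
    simpa using apply_eq_zero_of_pow_apply_eq_zero hA n w h

/-- Write the characteristic polynomial as `X^m q` with `q(0) ≠ 0`. Then `q(A)` annihilates the
range of `A` and acts as the scalar `q(0)` on the kernel, so it is `q(0)` times the kernel
projection. The formula exhibits how the projection depends on `A`; when `m` is fixed, this
dependence is smooth. -/
theorem coeff_smul_kerProj {A : F →L[ℝ] F} (hA : adjoint A = -A) {p : ℝ[X]} {m n : ℕ}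
    (hp : p = (A : F →ₗ[ℝ] F).charpoly) (hm : Module.finrank ℝ A.ker = m) (hn : p.natDegree ≤ n) :
    p.coeff m ≠ 0 ∧
    p.coeff m • kerProj A = ∑ i ∈ Finset.range (n + 1), p.coeff (i + m) • A ^ i := by
  have hmt : m = p.natTrailingDegree := by
    rw [← hm, finrank_ker_eq_natTrailingDegree_charpoly hA, hp]
  have hp0 : p ≠ 0 := by rw [hp]; exact (LinearMap.charpoly_monic _).ne_zero
  have hdvd : X ^ m ∣ p := by
    rw [X_pow_dvd_iff]
    intro d hd
    exact coeff_eq_zero_of_lt_natTrailingDegree (hmt ▸ hd)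
  have hc0 : p.coeff m ≠ 0 := by
    rw [hmt]; exact mt trailingCoeff_eq_zero.1 hp0
  refine ⟨hc0, ?_⟩
  obtain ⟨q, hq⟩ := hdvd
  have hqc : ∀ i, q.coeff i = p.coeff (i + m) := fun i => by rw [hq, coeff_X_pow_mul]
  set T : F →L[ℝ] F := ∑ i ∈ Finset.range (n + 1), p.coeff (i + m) • A ^ i with hT
  have hTq : T = aeval A q := by
    rw [aeval_eq_sum_range' (n := n + 1), hT]
    · simp_rw [hqc]
    · by_cases hq0 : q = 0
      · simp [hq0]
      · have : p.natDegree = m + q.natDegree := by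
          rw [hq, natDegree_mul (pow_ne_zero _ X_ne_zero) hq0]; simp
        omega
  have hCH : aeval A p = 0 := by
    have h := LinearMap.aeval_self_charpoly (A : F →ₗ[ℝ] F)
    rw [← hp] at h
    let Φ : (F →L[ℝ] F) →ₐ[ℝ] (F →ₗ[ℝ] F) :=
      { ContinuousLinearMap.toLinearMapRingHom with commutes' := fun _ => rfl }
    have h2 := aeval_algHom_apply Φ A p
    have h3 : aeval (Φ A) p = 0 := h
    rw [h3] at h2
    exact ContinuousLinearMap.coe_injective h2.symm
  -- Cayley–Hamilton gives `A^m q(A) = 0`, and skewness lowers the power of `A` to one.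
  have hAT : ∀ w, A (T w) = 0 := by
    intro w
    apply apply_eq_zero_of_pow_apply_eq_zero hA m
    rw [hTq, ← mul_apply_eq_comp]
    have : A ^ m * aeval A q = aeval A p := by rw [hq]; simp
    rw [this, hCH]; simp
  have hTA : ∀ w, T (A w) = 0 := by
    intro w
    have : T * A = A * T := by
      rw [hTq]
      simpa using congrArg (aeval A) (mul_comm q X)
    rw [← mul_apply_eq_comp, this, mul_apply_eq_comp, hAT]
  ext w
  obtain ⟨y, hy⟩ := exists_eq_kerProj_add hA w
  have hTk : T (kerProj A w) = p.coeff m • kerProj A w := by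
    rw [hT, _root_.sum_apply, Finset.sum_eq_single 0]
    · simp
    · intro i _ hi
      obtain ⟨j, rfl⟩ := Nat.exists_eq_succ_of_ne_zero hi
      simp [pow_succ, apply_kerProj]
    · simp
  conv_rhs => rw [hy]
  rw [map_add, hTA, hTk]; simp

/-- If `ν ^ 2 ≥ s ^ 2` for all nonzero eigenvalues `ν ^ 2` of `-A ^ 2`, then `|A w|` is at least `s`
times the distance of `w` to the kernel of `A`. -/
theorem le_norm_apply_of_forall_eigenvalue {A : F →L[ℝ] F} (hA : adjoint A = -A) {s : ℝ}
    (hs0 : 0 ≤ s)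
    (hs : ∀ (ν : ℝ) (v : F), 0 < ν → v ≠ 0 → A (A v) = -(ν ^ 2 • v) → s ≤ ν) (w : F) :
    s * ‖w - kerProj A w‖ ≤ ‖A w‖ := by
  set T : F →ₗ[ℝ] F := -((A : F →ₗ[ℝ] F) ∘ₗ (A : F →ₗ[ℝ] F)) with hT
  have hTa : ∀ v, T v = -(A (A v)) := fun v => rfl
  have hsym : T.IsSymmetric := by
    intro v w
    rw [hTa, hTa, inner_neg_left, inner_neg_right, inner_skew hA, inner_skew hA, neg_neg]
  -- In an orthonormal eigenbasis of the symmetric operator `-A²`, the eigenvalue at `e i` is `‖A (e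
  -- i)‖²`, so the inequality can be checked coefficient by coefficient.
  let e := hsym.eigenvectorBasis (n := Module.finrank ℝ F) rfl
  have he : ∀ i, A (A (e i)) = -(hsym.eigenvalues rfl i • e i) := by
    intro i
    have := hsym.apply_eigenvectorBasis rfl i
    rw [hTa] at this
    have h2 : A (A (e i)) = - -(A (A (e i))) := by simp
    rw [h2, this]; rfl
  have hsq : (s * ‖w - kerProj A w‖) ^ 2 ≤ ‖A w‖ ^ 2 := by
    have h1 : ‖A w‖ ^ 2 = ∑ i, hsym.eigenvalues rfl i * inner ℝ (e i) w ^ 2 := by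
      rw [← real_inner_self_eq_norm_sq, inner_skew hA, ← inner_neg_right, ← hTa,
        ← OrthonormalBasis.sum_inner_mul_inner e]
      refine Finset.sum_congr rfl fun i _ => ?_
      rw [← hsym, hTa, he, neg_neg, real_inner_smul_left, real_inner_comm w]
      ring
    have h2 : ‖w - kerProj A w‖ ^ 2 = ∑ i, inner ℝ (e i) (w - kerProj A w) ^ 2 := by
      rw [← OrthonormalBasis.sum_sq_inner_right e]
    rw [mul_pow, h1, h2, Finset.mul_sum]
    refine Finset.sum_le_sum fun i _ => ?_
    have hAe : ‖A (e i)‖ ^ 2 = hsym.eigenvalues rfl i := by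
      rw [← real_inner_self_eq_norm_sq, inner_skew hA, he, inner_neg_right, real_inner_smul_right,
        real_inner_self_eq_norm_sq, e.orthonormal.1 i]
      simp
    have hP : inner ℝ (e i) (w - kerProj A w) = inner ℝ (e i - kerProj A (e i)) w := by
      rw [inner_sub_left, inner_sub_right]
      congr 1
      exact (Submodule.inner_starProjection_left_eq_right _ _ _).symm
    rw [hP]
    by_cases h0 : A (e i) = 0
    · rw [kerProj_apply_of_apply_eq_zero h0, ← hAe, h0]; simp
    · have hν : 0 < ‖A (e i)‖ := norm_pos_iff.2 h0
      have hle := hs ‖A (e i)‖ (e i) hν (e.orthonormal.ne_zero i) (by rw [he, hAe])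
      -- An eigenvector of `A²` with nonzero eigenvalue lies in the range of `A`, hence is
      -- orthogonal to the kernel.
      have hk : kerProj A (e i) = 0 := by
        have : e i = A (-((‖A (e i)‖ ^ 2)⁻¹ • A (e i))) := by
          rw [map_neg, map_smul, he, ← hAe, smul_neg, neg_neg, smul_smul,
            inv_mul_cancel₀ (by positivity), one_smul]
        rw [this, ← mul_apply_eq_comp, kerProj_mul hA]; simp
      rw [hk, sub_zero, ← hAe]
      gcongr
  exact (sq_le_sq₀ (by positivity) (by positivity)).1 hsq

end SkewAdjoint

/-! ### Differentiating the kernel projection -/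

/-- Bounds for the first and second derivatives `P₁, P₂` of the projection `P` onto the kernel of `A`
along a curve, from the differentiated identities. -/
theorem norm_deriv_kerProj_le {F : Type*} [NormedAddCommGroup F] [InnerProductSpace ℝ F]
    [CompleteSpace F] {A A₁ A₂ P P₁ P₂ : F →L[ℝ] F} {C s : ℝ} (hC : 0 ≤ C) (hs0 : 0 < s)
    (hP : ‖P‖ ≤ 1)
    (hs : ∀ w, s * ‖w - P w‖ ≤ ‖A w‖) (hA₁ : ‖A₁‖ ≤ C * s) (hA₂ : ‖A₂‖ ≤ C * s)
    (h₁ : A₁ * P + A * P₁ = 0) (h₂ : A₂ * P + A₁ * P₁ + (A₁ * P₁ + A * P₂) = 0)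
    (hP₁ : P₁ * P + P * P₁ = P₁) (hP₂ : P₂ * P + P₁ * P₁ + (P₁ * P₁ + P * P₂) = P₂)
    (hst : star P = P) (hst₁ : star P₁ = P₁) (hst₂ : star P₂ = P₂) :
    ‖P₁‖ ≤ 2 * C ∧ ‖P₂‖ ≤ 2 * C + 16 * C ^ 2 := by
  -- The spectral gap `s` converts a bound `K s` on `A X` into the bound `K` on the part of `X` with
  -- values off the kernel; the factor `s` from the bounds on `A₁` and `A₂` cancels here.
  have key : ∀ (X : F →L[ℝ] F) (K : ℝ), 0 ≤ K → ‖A * X‖ ≤ K * s → ‖X - P * X‖ ≤ K := by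
    intro X K hK hX
    refine ContinuousLinearMap.opNorm_le_bound _ hK fun w => ?_
    have h1 := hs (X w)
    have h2 : ‖A (X w)‖ ≤ K * s * ‖w‖ := (ContinuousLinearMap.le_opNorm (A * X) w).trans (by gcongr)
    have h3 : s * ‖X w - P (X w)‖ ≤ s * (K * ‖w‖) := by linarith
    exact le_of_mul_le_mul_left h3 hs0
  have a1 : ‖P₁ - P * P₁‖ ≤ C := by
    apply key _ _ hC
    rw [eq_neg_of_add_eq_zero_right h₁, norm_neg]
    calc ‖A₁ * P‖ ≤ ‖A₁‖ * ‖P‖ := norm_mul_le _ _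
      _ ≤ (C * s) * 1 := by gcongr
      _ = C * s := mul_one _
  -- This is the adjoint of `a1`. The two together suffice, since `P₁ P + P P₁ = P₁` makes their sum
  -- equal to `P₁`.
  have a2 : ‖P₁ - P₁ * P‖ ≤ C := by
    rw [← norm_star]; simpa [hst, hst₁] using a1
  have b1 : ‖P₁‖ ≤ 2 * C := by
    have : P₁ = (P₁ - P * P₁) + (P₁ - P₁ * P) := by
      have : (P₁ - P * P₁) + (P₁ - P₁ * P) = P₁ + P₁ - (P₁ * P + P * P₁) := by abel
      rw [this, hP₁]; abel
    calc ‖P₁‖ = ‖(P₁ - P * P₁) + (P₁ - P₁ * P)‖ := by rw [← this]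
      _ ≤ C + C := norm_add_le_of_le a1 a2
      _ = 2 * C := by ring
  refine ⟨b1, ?_⟩
  have a3 : ‖P₂ - P * P₂‖ ≤ C + 4 * C ^ 2 := by
    apply key _ _ (by positivity)
    have : A * P₂ = -(A₂ * P + (2 : ℝ) • (A₁ * P₁)) := by
      rw [two_smul]
      apply eq_neg_of_add_eq_zero_left
      rw [← h₂]; abel
    rw [this, norm_neg]
    calc ‖A₂ * P + (2 : ℝ) • (A₁ * P₁)‖ ≤ ‖A₂‖ * ‖P‖ + 2 * (‖A₁‖ * ‖P₁‖) := by
          refine norm_add_le_of_le (norm_mul_le _ _) ?_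
          rw [norm_smul]; simpa using norm_mul_le _ _
      _ ≤ (C * s) * 1 + 2 * ((C * s) * (2 * C)) := by gcongr
      _ = (C + 4 * C ^ 2) * s := by ring
  have a4 : ‖P₂ - P₂ * P‖ ≤ C + 4 * C ^ 2 := by
    rw [← norm_star]; simpa [hst, hst₂] using a3
  have a5 : ‖(2 : ℝ) • (P₁ * P₁)‖ ≤ 2 * ((2 * C) * (2 * C)) := by
    rw [norm_smul]
    have := norm_mul_le P₁ P₁
    simp only [Real.norm_ofNat]
    nlinarith [norm_nonneg P₁]
  -- The second derivative of `P² = P` yields the same decomposition as for `P₁`, with the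
  -- correction `2 P₁²`.
  have : P₂ = (P₂ - P * P₂) + (P₂ - P₂ * P) - (2 : ℝ) • (P₁ * P₁) := by
    rw [two_smul]
    have h := hP₂
    have h' : P₂ * P + P * P₂ = P₂ - (P₁ * P₁ + P₁ * P₁) := by
      rw [eq_sub_iff_add_eq]; nth_rewrite 3 [← h]; abel
    have : (P₂ - P * P₂) + (P₂ - P₂ * P) = P₂ + P₂ - (P₂ * P + P * P₂) := by abel
    rw [this, h']; abel
  calc ‖P₂‖ = ‖(P₂ - P * P₂) + (P₂ - P₂ * P) - (2 : ℝ) • (P₁ * P₁)‖ := by rw [← this]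
    _ ≤ ((C + 4 * C ^ 2) + (C + 4 * C ^ 2)) + 2 * ((2 * C) * (2 * C)) :=
      norm_sub_le_of_le (norm_add_le_of_le a3 a4) a5
    _ = 2 * C + 16 * C ^ 2 := by ring

/-! ### Partial derivatives -/

section PartialDerivatives

variable {k : ℕ} {G : Type*} [NormedAddCommGroup G] [NormedSpace ℝ G]

/-- The partial derivative `∂_a f` of a vector-valued function. -/
noncomputable def pderiv (a : Fin k) (f : EuclideanSpace ℝ (Fin k) → G)
    (x : EuclideanSpace ℝ (Fin k)) : G :=
  fderiv ℝ f x (EuclideanSpace.single a (1 : ℝ))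

theorem ContDiff.pderiv {m n : WithTop ℕ∞} {f : EuclideanSpace ℝ (Fin k) → G}
    (hf : ContDiff ℝ n f) (a : Fin k) (hmn : m + 1 ≤ n) : ContDiff ℝ m (pderiv a f) :=
  (hf.fderiv_right hmn).clm_apply contDiff_const

theorem ContDiffAt.pderiv {m n : WithTop ℕ∞} {f : EuclideanSpace ℝ (Fin k) → G}
    {x : EuclideanSpace ℝ (Fin k)}
    (hf : ContDiffAt ℝ n f x) (a : Fin k) (hmn : m + 1 ≤ n) : ContDiffAt ℝ m (pderiv a f) x :=
  (hf.fderiv_right hmn).clm_apply contDiffAt_const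

theorem HasCompactSupport.pderiv {f : EuclideanSpace ℝ (Fin k) → G}
    (hf : HasCompactSupport f) (a : Fin k) : HasCompactSupport (pderiv a f) :=
  hf.fderiv_apply ℝ _

theorem pderiv_congr {a : Fin k} {f g : EuclideanSpace ℝ (Fin k) → G}
    {x : EuclideanSpace ℝ (Fin k)} (h : f =ᶠ[nhds x] g) : pderiv a f x = pderiv a g x := by
  rw [pderiv, pderiv, h.fderiv_eq]

theorem pderiv_eventuallyEq {a : Fin k} {f g : EuclideanSpace ℝ (Fin k) → G}
    {x : EuclideanSpace ℝ (Fin k)} (h : f =ᶠ[nhds x] g) :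
    pderiv a f =ᶠ[nhds x] pderiv a g := by
  filter_upwards [h.eventually_nhds] with y hy using pderiv_congr hy

theorem pderiv_const (a : Fin k) (c : G) (x : EuclideanSpace ℝ (Fin k)) :
    pderiv a (fun _ => c) x = 0 := by simp [pderiv]

theorem pderiv_pderiv_eq {a b : Fin k} {f : EuclideanSpace ℝ (Fin k) → G}
    {x : EuclideanSpace ℝ (Fin k)} (hf : ContDiffAt ℝ 2 f x) :
    pderiv a (pderiv b f) x = fderiv ℝ (fderiv ℝ f) x (EuclideanSpace.single a 1)
      (EuclideanSpace.single b 1) := by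
  have h : DifferentiableAt ℝ (fderiv ℝ f) x :=
    (hf.fderiv_right (m := 1) (by norm_num)).differentiableAt (by norm_num)
  change fderiv ℝ (fun y => fderiv ℝ f y (EuclideanSpace.single b 1)) x _ = _
  rw [fderiv_clm_apply h (by fun_prop)]
  simp

theorem pderiv_comm {a b : Fin k} {f : EuclideanSpace ℝ (Fin k) → G}
    {x : EuclideanSpace ℝ (Fin k)} (hf : ContDiffAt ℝ 2 f x) :
    pderiv a (pderiv b f) x = pderiv b (pderiv a f) x := by
  rw [pderiv_pderiv_eq hf, pderiv_pderiv_eq hf]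
  exact hf.isSymmSndFDerivAt (by simp) _ _

theorem laplacian_eq_sum_pderiv {f : EuclideanSpace ℝ (Fin k) → G}
    {x : EuclideanSpace ℝ (Fin k)} (hf : ContDiffAt ℝ 2 f x) :
    (Δ f) x = ∑ a, pderiv a (pderiv a f) x := by
  rw [InnerProductSpace.laplacian_eq_iteratedFDeriv_orthonormalBasis f
    (EuclideanSpace.basisFun (Fin k) ℝ)]
  refine Finset.sum_congr rfl fun a _ => ?_
  rw [pderiv_pderiv_eq hf, iteratedFDeriv_two_apply]
  simp

theorem pderiv_add {a : Fin k} {f g : EuclideanSpace ℝ (Fin k) → G}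
    {x : EuclideanSpace ℝ (Fin k)} (hf : DifferentiableAt ℝ f x) (hg : DifferentiableAt ℝ g x) :
    pderiv a (fun y => f y + g y) x = pderiv a f x + pderiv a g x := by
  rw [pderiv, fderiv_fun_add hf hg]; rfl

theorem pderiv_smul {a : Fin k} {f : EuclideanSpace ℝ (Fin k) → ℝ}
    {g : EuclideanSpace ℝ (Fin k) → G}
    {x : EuclideanSpace ℝ (Fin k)} (hf : DifferentiableAt ℝ f x) (hg : DifferentiableAt ℝ g x) :
    pderiv a (fun y => f y • g y) x = pderiv a f x • g x + f x • pderiv a g x := by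
  rw [pderiv, fderiv_fun_smul hf hg, add_comm]; rfl

theorem pderiv_clm_apply {H : Type*} [NormedAddCommGroup H] [NormedSpace ℝ H] {a : Fin k}
    {T : EuclideanSpace ℝ (Fin k) → G →L[ℝ] H} {u : EuclideanSpace ℝ (Fin k) → G}
    {x : EuclideanSpace ℝ (Fin k)} (hT : DifferentiableAt ℝ T x) (hu : DifferentiableAt ℝ u x) :
    pderiv a (fun y => T y (u y)) x = pderiv a T x (u x) + T x (pderiv a u x) := by
  rw [pderiv, fderiv_clm_apply hT hu, add_comm]; rfl

theorem pderiv_clm_mul {a : Fin k} {S T : EuclideanSpace ℝ (Fin k) → G →L[ℝ] G}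
    {x : EuclideanSpace ℝ (Fin k)} (hS : DifferentiableAt ℝ S x) (hT : DifferentiableAt ℝ T x) :
    pderiv a (fun y => S y * T y) x = pderiv a S x * T x + S x * pderiv a T x := by
  rw [pderiv, fderiv_fun_mul' hS hT, add_comm]; rfl

theorem pderiv_star {F : Type*} [NormedAddCommGroup F] [InnerProductSpace ℝ F] [CompleteSpace F]
    {a : Fin k} {T : EuclideanSpace ℝ (Fin k) → F →L[ℝ] F}
    {x : EuclideanSpace ℝ (Fin k)} :
    pderiv a (fun y => star (T y)) x = star (pderiv a T x) := by
  have h := fderiv_star (𝕜 := ℝ) (f := T) (x := x)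
  rw [pderiv, h]; rfl

theorem partialDeriv_one (a : Fin 1 → Fin k) (f : EuclideanSpace ℝ (Fin k) → ℝ)
    (x : EuclideanSpace ℝ (Fin k)) : partialDeriv a f x = pderiv (a 0) f x := by
  rw [partialDeriv, iteratedFDeriv_one_apply]; rfl

theorem partialDeriv_two (a : Fin 2 → Fin k) {f : EuclideanSpace ℝ (Fin k) → ℝ}
    {x : EuclideanSpace ℝ (Fin k)} (hf : ContDiffAt ℝ 2 f x) :
    partialDeriv a f x = pderiv (a 0) (pderiv (a 1) f) x := by
  rw [partialDeriv, iteratedFDeriv_two_apply, pderiv_pderiv_eq hf]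

end PartialDerivatives

/-! ### Matrix fields as operator-valued functions -/

section MatrixFields

variable {k d : ℕ}

/-- The operator of multiplication by the matrix `M x` on `ℝᵈ`. -/
noncomputable def opField (M : EuclideanSpace ℝ (Fin k) → Matrix (Fin d) (Fin d) ℝ)
    (x : EuclideanSpace ℝ (Fin k)) : EuclideanSpace ℝ (Fin d) →L[ℝ] EuclideanSpace ℝ (Fin d) :=
  toEuclideanCLM (n := Fin d) (𝕜 := ℝ) (M x)

variable {M : EuclideanSpace ℝ (Fin k) → Matrix (Fin d) (Fin d) ℝ}

theorem mulField_apply (u : EuclideanSpace ℝ (Fin k) → EuclideanSpace ℝ (Fin d))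
    (x : EuclideanSpace ℝ (Fin k)) : mulField M u x = opField M x (u x) := rfl

/-- Expansion in matrix units transfers smoothness, derivatives and bounds from the entries to the
operator field. -/
theorem opField_eq_sum :
    opField M = fun x => ∑ i, ∑ j, M x i j •
      toEuclideanCLM (n := Fin d) (𝕜 := ℝ) (Matrix.single i j (1 : ℝ)) := by
  ext1 x
  rw [opField]
  conv_lhs => rw [matrix_eq_sum_single (M x)]
  simp only [map_sum]
  refine Finset.sum_congr rfl fun i _ => Finset.sum_congr rfl fun j _ => ?_
  rw [← map_smul, smul_single, smul_eq_mul, mul_one]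

theorem contDiff_opField {n : WithTop ℕ∞} (hM : ∀ i j, ContDiff ℝ n (fun x => M x i j)) :
    ContDiff ℝ n (opField M) := by
  rw [opField_eq_sum]
  exact ContDiff.sum fun i _ => ContDiff.sum fun j _ => (hM i j).smul contDiff_const

theorem pderiv_sum {ι G : Type*} [NormedAddCommGroup G] [NormedSpace ℝ G] {a : Fin k}
    {f : ι → EuclideanSpace ℝ (Fin k) → G} {s : Finset ι}
    {x : EuclideanSpace ℝ (Fin k)} (hf : ∀ i ∈ s, DifferentiableAt ℝ (f i) x) :
    pderiv a (fun y => ∑ i ∈ s, f i y) x = ∑ i ∈ s, pderiv a (f i) x := by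
  rw [pderiv, fderiv_fun_sum hf, _root_.sum_apply]; rfl

theorem pderiv_opField_of_differentiable (hM : ∀ i j, Differentiable ℝ (fun x => M x i j))
    (a : Fin k) :
    pderiv a (opField M) = opField (fun x => Matrix.of fun i j => pderiv a (fun y => M y i j) x) := by
  ext1 x
  rw [opField_eq_sum, opField_eq_sum, pderiv_sum fun i _ => ?_]
  · refine Finset.sum_congr rfl fun i _ => ?_
    rw [pderiv_sum fun j _ => ?_]
    · refine Finset.sum_congr rfl fun j _ => ?_
      rw [pderiv_smul (hM i j x) (by fun_prop), pderiv_const, smul_zero, add_zero]; rfl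
    · exact (hM i j x).smul_const _
  · exact DifferentiableAt.fun_sum fun j _ => (hM i j x).smul_const _

/-- The sum of the operator norms of the matrix units. -/
noncomputable def unitNormSum (d : ℕ) : ℝ :=
  ∑ i : Fin d, ∑ j : Fin d, ‖toEuclideanCLM (n := Fin d) (𝕜 := ℝ) (Matrix.single i j (1 : ℝ))‖

theorem unitNormSum_nonneg (d : ℕ) : 0 ≤ unitNormSum d :=
  Finset.sum_nonneg fun _ _ => Finset.sum_nonneg fun _ _ => norm_nonneg _

theorem norm_opField_le {x : EuclideanSpace ℝ (Fin k)} {B : ℝ} (h : ∀ i j, |M x i j| ≤ B) :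
    ‖opField M x‖ ≤ unitNormSum d * B := by
  rw [opField_eq_sum, unitNormSum, Finset.sum_mul]
  refine norm_sum_le_of_le _ fun i _ => ?_
  rw [Finset.sum_mul]
  refine norm_sum_le_of_le _ fun j _ => ?_
  rw [norm_smul, mul_comm]
  gcongr
  exact h i j

theorem adjoint_opField (hM : ∀ x, (M x)ᵀ = -M x) (x : EuclideanSpace ℝ (Fin k)) :
    ContinuousLinearMap.adjoint (opField M x) = -opField M x := by
  rw [← ContinuousLinearMap.star_eq_adjoint, opField, ← map_star, star_eq_conjTranspose,
    conjTranspose_eq_transpose_of_trivial, hM, map_neg]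

theorem finrank_ker_opField (x : EuclideanSpace ℝ (Fin k)) :
    Module.finrank ℝ (opField M x).ker = dimKer (M x) := by
  have h : (opField M x).ker =
      (LinearMap.ker (Matrix.toLin' (M x))).map
        ((WithLp.linearEquiv 2 ℝ (Fin d → ℝ)).symm : (Fin d → ℝ) →ₗ[ℝ] EuclideanSpace ℝ (Fin d)) := by
    ext w
    rw [Submodule.mem_map_equiv]
    simp only [LinearMap.mem_ker, LinearEquiv.symm_symm, toLin'_apply, WithLp.linearEquiv_apply]
    rw [ContinuousLinearMap.coe_coe, opField, ← (WithLp.ofLp_injective 2).eq_iff]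
    rfl
  rw [h, dimKer]
  exact LinearEquiv.finrank_map_eq (WithLp.linearEquiv 2 ℝ (Fin d → ℝ)).symm _

theorem charpoly_opField (x : EuclideanSpace ℝ (Fin k)) :
    (opField M x : EuclideanSpace ℝ (Fin d) →ₗ[ℝ] EuclideanSpace ℝ (Fin d)).charpoly
      = (M x).charpoly := by
  rw [opField, coe_toEuclideanCLM_eq_toEuclideanLin, show toEuclideanLin (M x)
        = Matrix.toLin (PiLp.basisFun 2 ℝ (Fin d)) (PiLp.basisFun 2 ℝ (Fin d)) (M x)
      from congrFun (congrArg DFunLike.coe (toLpLin_eq_toLin 2 2)) (M x),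
    ← LinearMap.charpoly_toMatrix _ (PiLp.basisFun 2 ℝ (Fin d)), LinearMap.toMatrix_toLin]

/-- Each coefficient is a fixed polynomial in the entries, read off from the universal
characteristic polynomial. -/
theorem contDiff_charpoly_coeff {n : WithTop ℕ∞} (hM : ∀ i j, ContDiff ℝ n (fun x => M x i j))
    (l : ℕ) : ContDiff ℝ n (fun x => (M x).charpoly.coeff l) := by
  have h : ∀ p : MvPolynomial (Fin d × Fin d) ℝ, ContDiff ℝ n
      (fun x => MvPolynomial.eval₂Hom (RingHom.id ℝ) (fun ij : Fin d × Fin d => M x ij.1 ij.2) p) := by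
    intro p
    induction p using MvPolynomial.induction_on with
    | C c => simpa using contDiff_const
    | add p q hp hq => simpa only [map_add] using hp.add hq
    | mul_X p ij hp =>
      simp only [map_mul, MvPolynomial.eval₂Hom_X']
      exact hp.mul (hM _ _)
  have h2 := h ((Matrix.charpoly.univ ℝ (Fin d)).coeff l)
  simp only [Matrix.charpoly.univ_coeff_eval₂Hom] at h2
  exact h2

/-- While the kernel dimension stays equal to `m`, the polynomial formula `coeff_smul_kerProj` holds
with the same `m` and a nonvanishing coefficient to divide by. -/
theorem contDiffAt_kerProj {n : WithTop ℕ∞} (hM : ∀ i j, ContDiff ℝ n (fun x => M x i j))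
    (hskew : ∀ x, (M x)ᵀ = -M x) {m : ℕ} {x : EuclideanSpace ℝ (Fin k)}
    (hm : ∀ᶠ y in nhds x, dimKer (M y) = m) :
    ContDiffAt ℝ n (fun y => kerProj (opField M y)) x := by
  have key := fun y (hy : dimKer (M y) = m) =>
    coeff_smul_kerProj (p := (M y).charpoly) (n := d) (adjoint_opField hskew y)
    (charpoly_opField y).symm ((finrank_ker_opField y).trans hy)
    (by rw [Matrix.charpoly_natDegree_eq_dim]; simp)
  have heq : (fun y => kerProj (opField M y)) =ᶠ[nhds x] fun y => ((M y).charpoly.coeff m)⁻¹ •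
      ∑ i ∈ Finset.range (d + 1), (M y).charpoly.coeff (i + m) • opField M y ^ i := by
    filter_upwards [hm] with y hy
    rw [← (key y hy).2, smul_smul, inv_mul_cancel₀ (key y hy).1, one_smul]
  refine ContDiffAt.congr_of_eventuallyEq ?_ heq
  refine ((contDiff_charpoly_coeff hM m).contDiffAt.inv (key x hm.self_of_nhds).1).smul ?_
  refine ContDiffAt.sum fun i _ => ?_
  exact (contDiff_charpoly_coeff hM _).contDiffAt.smul ((contDiff_opField hM).contDiffAt.pow i)

/-- The spectrum is finite, so the infimum is either over the empty set or attained at a nonzero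
eigenvalue. -/
theorem minNonzeroEigenvalueModulus_pos (A : Matrix (Fin d) (Fin d) ℝ) :
    0 < minNonzeroEigenvalueModulus A := by
  set T := spectrum ℂ (A.map (algebraMap ℝ ℂ)) \ {0} with hT
  have hfin : T.Finite := (Matrix.finite_spectrum _).subset Set.sdiff_subset
  rw [minNonzeroEigenvalueModulus, ← hT]
  rcases T.eq_empty_or_nonempty with h | h
  · simp [h]
  · obtain ⟨z, hz, hmin⟩ := Set.exists_min_image T (fun z => ‖z‖ₑ) hfin h
    refine lt_of_lt_of_le ?_ (le_iInf₂ hmin)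
    exact enorm_pos.2 hz.2

/-- If `A²v = -ν²v`, the complex vector `Av + iνv` is an eigenvector of `A` for `iν`. It is nonzero
because its imaginary part is `νv`. -/
theorem minNonzeroEigenvalueModulus_le {A : Matrix (Fin d) (Fin d) ℝ} {ν : ℝ}
    {v : EuclideanSpace ℝ (Fin d)} (hν : 0 < ν) (hv : v ≠ 0)
    (h : toEuclideanCLM (n := Fin d) (𝕜 := ℝ) A (toEuclideanCLM (n := Fin d) (𝕜 := ℝ) A v)
      = -(ν ^ 2 • v)) :
    minNonzeroEigenvalueModulus A ≤ ENNReal.ofReal ν := by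
  have hz0 : (Complex.I * ν : ℂ) ≠ 0 := by simp [hν.ne']
  have hv2 : A *ᵥ (A *ᵥ v.ofLp) = -(ν ^ 2 • v.ofLp) := congrArg WithLp.ofLp h
  have hmem : (Complex.I * ν : ℂ) ∈ spectrum ℂ (A.map (algebraMap ℝ ℂ)) := by
    set c : (Fin d → ℝ) → (Fin d → ℂ) := fun w i => (w i : ℂ) with hc
    have hAc : ∀ w, A.map (algebraMap ℝ ℂ) *ᵥ c w = c (A *ᵥ w) := by
      intro w
      ext i
      simp [hc, mulVec, dotProduct]
    have hcn : ∀ w, c (-w) = -c w := fun w => by ext; simp [hc]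
    have hcs : ∀ (r : ℝ) w, c (r • w) = (r : ℂ) • c w := fun r w => by ext; simp [hc]
    set w := c (A *ᵥ v.ofLp) + (Complex.I * ν) • c v.ofLp with hw
    have hw0 : w ≠ 0 := by
      intro hw0
      apply hv
      ext i
      have := congrArg Complex.im (congrFun hw0 i)
      simpa [hw, hc, hν.ne'] using this
    rw [← Matrix.spectrum_toLin', ← Module.End.hasEigenvalue_iff_mem_spectrum]
    refine Module.End.hasEigenvalue_of_hasEigenvector (x := w) ⟨?_, hw0⟩
    rw [Module.End.mem_eigenspace_iff, toLin'_apply, hw, mulVec_add, mulVec_smul, hAc, hAc, hv2,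
      hcn, hcs, smul_add, smul_smul, add_comm]
    congr 1
    rw [← neg_smul]
    congr 1
    have := Complex.I_sq
    push_cast
    linear_combination -(ν : ℂ) ^ 2 * this
  refine (iInf₂_le _ ⟨hmem, hz0⟩).trans ?_
  rw [← ofReal_norm]
  simp [abs_of_pos hν]

/-- The two forms in which the eigenvalue condition is used. -/
theorem exists_spectral_bound (hskew : ∀ x, (M x)ᵀ = -M x) {C : ℝ} (hC : 0 < C)
    {x : EuclideanSpace ℝ (Fin k)}
    (h : ∀ (i j : Fin d) (n : ℕ), 1 ≤ n → n ≤ 2 → ∀ a : Fin n → Fin k,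
      ENNReal.ofReal |partialDeriv a (fun y => M y i j) x|
        ≤ ENNReal.ofReal C * minNonzeroEigenvalueModulus (M x)) :
    ∃ s : ℝ, 0 < s ∧ (∀ w, s * ‖w - kerProj (opField M x) w‖ ≤ ‖opField M x w‖) ∧
      ∀ (i j : Fin d) (n : ℕ), 1 ≤ n → n ≤ 2 → ∀ a : Fin n → Fin k,
        |partialDeriv a (fun y => M y i j) x| ≤ C * s := by
  set S := minNonzeroEigenvalueModulus (M x) with hS
  have key : ∀ s : ℝ, 0 ≤ s → ENNReal.ofReal s ≤ S →
      ∀ w, s * ‖w - kerProj (opField M x) w‖ ≤ ‖opField M x w‖ := by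
    intro s hs0 hs w
    refine le_norm_apply_of_forall_eigenvalue (adjoint_opField hskew x) hs0
      (fun ν v hν hv hvv => ?_) w
    exact (ENNReal.ofReal_le_ofReal_iff hν.le).1
      (hs.trans (minNonzeroEigenvalueModulus_le hν hv hvv))
  -- When there is no nonzero eigenvalue, the lower bound holds for every `s ≥ 0`. A real `s` is
  -- then chosen so large that `C s` dominates all derivatives of order one and two at `x`.
  by_cases htop : S = ⊤
  · set N : ℕ → ℝ := fun n => ∑ i, ∑ j, ∑ a : Fin n → Fin k, |partialDeriv a (fun y => M y i j) x|
      with hN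
    have hN0 : ∀ n, 0 ≤ N n := fun n => by positivity
    have hle : ∀ (i j : Fin d) n (a : Fin n → Fin k),
        |partialDeriv a (fun y => M y i j) x| ≤ N n := by
      intro i j n a
      calc _ ≤ ∑ a : Fin n → Fin k, |partialDeriv a (fun y => M y i j) x| :=
            Finset.single_le_sum (f := fun a => |partialDeriv a (fun y => M y i j) x|)
              (fun _ _ => abs_nonneg _) (Finset.mem_univ a)
        _ ≤ ∑ j, ∑ a : Fin n → Fin k, |partialDeriv a (fun y => M y i j) x| :=
            Finset.single_le_sum
              (f := fun j => ∑ a : Fin n → Fin k, |partialDeriv a (fun y => M y i j) x|)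
              (fun _ _ => by positivity) (Finset.mem_univ j)
        _ ≤ N n := Finset.single_le_sum
              (f := fun i => ∑ j, ∑ a : Fin n → Fin k, |partialDeriv a (fun y => M y i j) x|)
              (fun _ _ => by positivity) (Finset.mem_univ i)
    have h1 := hN0 1
    have h2 := hN0 2
    refine ⟨1 + (N 1 + N 2) / C, by positivity,
      key _ (by positivity) (by rw [htop]; exact le_top), fun i j n hn1 hn2 a => ?_⟩
    refine (hle i j n a).trans ?_
    rw [mul_add, mul_div_cancel₀ _ hC.ne']
    interval_cases n <;> linarith
  · refine ⟨S.toReal, ENNReal.toReal_pos (minNonzeroEigenvalueModulus_pos _).ne' htop,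
      key _ ENNReal.toReal_nonneg (by rw [ENNReal.ofReal_toReal htop]), fun i j n hn1 hn2 a => ?_⟩
    have := h i j n hn1 hn2 a
    rw [← ENNReal.ofReal_toReal htop, ← ENNReal.ofReal_mul hC.le] at this
    exact (ENNReal.ofReal_le_ofReal_iff (by positivity)).1 this

end MatrixFields

/-! ### The truncated projection onto the range of the potential -/

section CutoffProjection

variable {k d : ℕ} {M : EuclideanSpace ℝ (Fin k) → Matrix (Fin d) (Fin d) ℝ}

/-- Where the kernel of `M` has constant dimension and the derivatives of `M` are controlled by its
nonzero eigenvalues, the derivatives of the projection onto the kernel are bounded. -/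
theorem norm_pderiv_kerProj_le (hM : ∀ i j, ContDiff ℝ 2 (fun x => M x i j))
    (hskew : ∀ x, (M x)ᵀ = -M x) {m : ℕ} {x : EuclideanSpace ℝ (Fin k)}
    (hm : ∀ᶠ y in nhds x, dimKer (M y) = m) {C s : ℝ} (hC : 0 ≤ C) (hs0 : 0 < s)
    (hs : ∀ w, s * ‖w - kerProj (opField M x) w‖ ≤ ‖opField M x w‖) (a : Fin k)
    (h1 : ‖pderiv a (opField M) x‖ ≤ C * s) (h2 : ‖pderiv a (pderiv a (opField M)) x‖ ≤ C * s) :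
    ‖pderiv a (fun y => kerProj (opField M y)) x‖ ≤ 2 * C ∧
    ‖pderiv a (pderiv a (fun y => kerProj (opField M y))) x‖ ≤ 2 * C + 16 * C ^ 2 := by
  set A := opField M with hA
  set P := fun y => kerProj (A y) with hP
  have hA2 : ContDiff ℝ 2 A := contDiff_opField hM
  have hP2 : ∀ᶠ y in nhds x, ContDiffAt ℝ 2 P y := by
    filter_upwards [hm.eventually_nhds] with y hy using contDiffAt_kerProj hM hskew hy
  have hPd : ∀ᶠ y in nhds x, DifferentiableAt ℝ P y := by
    filter_upwards [hP2] with y hy using hy.differentiableAt (by norm_num)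
  have hAd : Differentiable ℝ A := hA2.differentiable (by norm_num)
  have hAd' : Differentiable ℝ (pderiv a A) :=
    (hA2.pderiv a (m := 1) (by norm_num)).differentiable (by norm_num)
  have hPd' : DifferentiableAt ℝ (pderiv a P) x :=
    (hP2.self_of_nhds.pderiv a (m := 1) (by norm_num)).differentiableAt (by norm_num)
  -- The first-order identities are established on a neighbourhood of `x`, not only at `x`, so that
  -- they can be differentiated once more.
  have e1 : (fun y => pderiv a A y * P y + A y * pderiv a P y) =ᶠ[nhds x] fun _ => 0 := by
    filter_upwards [hPd] with y hy
    rw [← pderiv_clm_mul (hAd y) hy]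
    have : (fun y => A y * P y) = fun _ => 0 := by
      ext1 y; exact mul_kerProj _
    rw [this, pderiv_const]
  have e2 : (fun y => pderiv a P y * P y + P y * pderiv a P y) =ᶠ[nhds x] pderiv a P := by
    filter_upwards [hPd] with y hy
    rw [← pderiv_clm_mul hy hy]
    have : (fun y => P y * P y) = P := by
      ext1 y; exact kerProj_mul_kerProj _
    rw [this]
  have hPx := hPd.self_of_nhds
  have hstar : ∀ y, star (pderiv a P y) = pderiv a P y := by
    intro y
    rw [← pderiv_star]
    congr 1
    ext1 z; exact star_kerProj _
  refine norm_deriv_kerProj_le (A := A x) (P := P x) hC hs0 (norm_kerProj_le _) hs h1 h2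
    e1.self_of_nhds ?_ e2.self_of_nhds ?_ (star_kerProj _) (hstar x) ?_
  · rw [← pderiv_clm_mul (hAd' x) hPx, ← pderiv_clm_mul (hAd x) hPd', ← pderiv_add,
      pderiv_congr e1, pderiv_const]
    · exact (hAd' x).mul hPx
    · exact (hAd x).mul hPd'
  · rw [← pderiv_clm_mul hPd' hPx, ← pderiv_clm_mul hPx hPd', ← pderiv_add, pderiv_congr e2]
    · exact hPd'.mul hPx
    · exact hPx.mul hPd'
  · rw [← pderiv_star]
    congr 1
    ext1 y; exact hstar y

/-- A bounded `C²` operator field `Q` with bounded derivatives that differs from the projection onto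
the range of `M` in a bounded region only and is localized to where the derivatives of `M` are
controlled by `M`. -/
theorem exists_cutoff_projection (hM : ∀ i j, ContDiff ℝ 2 (fun x => M x i j))
    (hskew : ∀ x, (M x)ᵀ = -M x) {C R : ℝ} (hC : 0 < C) {m : ℕ}
    (hder : ∀ x : EuclideanSpace ℝ (Fin k), R ≤ ‖x‖ → ∀ (i j : Fin d) (n : ℕ), 1 ≤ n → n ≤ 2 →
      ∀ a : Fin n → Fin k, ENNReal.ofReal |partialDeriv a (fun y => M y i j) x|
        ≤ ENNReal.ofReal C * minNonzeroEigenvalueModulus (M x))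
    (hm : ∀ x : EuclideanSpace ℝ (Fin k), R ≤ ‖x‖ → dimKer (M x) = m) (hR : 0 < R) :
    ∃ (Q : EuclideanSpace ℝ (Fin k) → EuclideanSpace ℝ (Fin d) →L[ℝ] EuclideanSpace ℝ (Fin d))
      (B : ℝ), 0 ≤ B ∧ ContDiff ℝ 2 Q ∧ (∀ x, ‖Q x‖ ≤ B) ∧ (∀ a x, ‖pderiv a Q x‖ ≤ B) ∧
      (∀ a x, ‖pderiv a (pderiv a Q) x‖ ≤ B) ∧ (∀ x, Q x * opField M x = opField M x * Q x) ∧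
      (∀ x, ‖opField M x - opField M x * Q x‖ ≤ B) ∧
      ∀ a x w, ‖pderiv a (opField M) x (Q x w)‖ ≤ B * ‖opField M x (Q x w)‖ := by
  set A := opField M with hA
  set P := fun y => kerProj (A y) with hP
  have hA2 : ContDiff ℝ 2 A := contDiff_opField hM
  set K := unitNormSum d * C with hK
  have hK0 : 0 ≤ K := mul_nonneg (unitNormSum_nonneg d) hC.le
  have hMd : ∀ i j, Differentiable ℝ (fun x => M x i j) := fun i j =>
    (hM i j).differentiable (by norm_num)
  have hMd' : ∀ a i j, Differentiable ℝ (pderiv a (fun x => M x i j)) := fun a i j =>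
    ((hM i j).pderiv a (m := 1) (by norm_num)).differentiable (by norm_num)
  have hspec : ∀ x : EuclideanSpace ℝ (Fin k), R ≤ ‖x‖ → ∃ s : ℝ, 0 < s ∧
      (∀ w, s * ‖w - P x w‖ ≤ ‖A x w‖) ∧ ∀ a, ‖pderiv a A x‖ ≤ K * s ∧
      ‖pderiv a (pderiv a A) x‖ ≤ K * s := by
    intro x hx
    obtain ⟨s, hs0, hs, hb⟩ := exists_spectral_bound hskew hC (hder x hx)
    refine ⟨s, hs0, hs, fun a => ⟨?_, ?_⟩⟩
    · rw [hA, pderiv_opField_of_differentiable hMd, hK, mul_assoc]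
      refine norm_opField_le fun i j => ?_
      have := hb i j 1 le_rfl (by norm_num) (fun _ => a)
      rwa [partialDeriv_one] at this
    · rw [hA, pderiv_opField_of_differentiable hMd,
        pderiv_opField_of_differentiable (fun i j => by simpa using hMd' a i j), hK, mul_assoc]
      refine norm_opField_le fun i j => ?_
      have := hb i j 2 (by norm_num) le_rfl (fun _ => a)
      rwa [partialDeriv_two _ (hM i j).contDiffAt] at this
  have hev : ∀ x : EuclideanSpace ℝ (Fin k), R < ‖x‖ → ∀ᶠ y in nhds x, dimKer (M y) = m := by
    intro x hx
    filter_upwards [continuous_norm.continuousAt.eventually (lt_mem_nhds hx)] with y hy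
    exact hm y (le_of_lt hy)
  -- The cutoff equals 1 up to radius `R + 1`, so `Q` vanishes on a neighbourhood of the ball of
  -- radius `R`, where the projection need not be continuous. Beyond `R + 2`, `Q` is exactly `1 -
  -- P`.
  let f : ContDiffBump (0 : EuclideanSpace ℝ (Fin k)) :=
    ⟨R + 1, R + 2, by linarith, by linarith⟩
  set Q := fun x => (1 - f x) • (1 - P x) with hQ
  have hQ0 : ∀ x : EuclideanSpace ℝ (Fin k), ‖x‖ ≤ R + 1 → Q x = 0 := by
    intro x hx
    have : f x = 1 := f.one_of_mem_closedBall (by simpa [f] using hx)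
    simp [hQ, this]
  have hfC : ContDiff ℝ 2 f := f.contDiff
  have hQ2 : ContDiff ℝ 2 Q := by
    rw [contDiff_iff_contDiffAt]
    intro x
    by_cases hx : R < ‖x‖
    · exact (contDiff_const.sub hfC).contDiffAt.smul
        (contDiffAt_const.sub (contDiffAt_kerProj hM hskew (hev x hx)))
    · refine (contDiffAt_const (c := 0)).congr_of_eventuallyEq ?_
      have : ‖x‖ < R + 1 := by linarith [not_lt.1 hx]
      filter_upwards [continuous_norm.continuousAt.eventually (gt_mem_nhds this)] with y hy
      exact hQ0 y (le_of_lt hy)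
  have hPA : ∀ x, P x * A x = 0 := fun x => kerProj_mul (adjoint_opField hskew x)
  have hfar : ∀ x : EuclideanSpace ℝ (Fin k), R + 2 < ‖x‖ → Q =ᶠ[nhds x] fun y => 1 - P y := by
    intro x hx
    filter_upwards [continuous_norm.continuousAt.eventually (lt_mem_nhds hx)] with y hy
    have : f y = 0 := f.zero_of_le_dist (by simpa [f] using le_of_lt hy)
    simp [hQ, this]
  -- Both `A P` and `P A` vanish, so multiplying by `Q` on either side only truncates `A`. This
  -- yields the commutation and shows that `A - A Q = f A` has compact support.
  have hAQ : ∀ x, A x * Q x = (1 - f x) • A x := by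
    intro x
    ext1 w
    have : A x (P x w) = 0 := apply_kerProj _ _
    change A x ((1 - f x) • (w - P x w)) = (1 - f x) • A x w
    rw [map_smul, map_sub, this, sub_zero]
  have hQA : ∀ x, Q x * A x = (1 - f x) • A x := by
    intro x
    ext1 w
    have : P x (A x w) = 0 := DFunLike.congr_fun (hPA x) w
    change (1 - f x) • (A x w - P x (A x w)) = (1 - f x) • A x w
    rw [this, sub_zero]
  have hbdd : ∀ {G : Type} [NormedAddCommGroup G] {g : EuclideanSpace ℝ (Fin k) → G},
      Continuous g → ∃ B, ∀ x : EuclideanSpace ℝ (Fin k), ‖x‖ ≤ R + 2 → ‖g x‖ ≤ B := by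
    intro G _ g hg
    obtain ⟨B, hB⟩ := (isCompact_closedBall (0 : EuclideanSpace ℝ (Fin k)) (R + 2)).exists_bound_of_continuousOn
      hg.continuousOn
    exact ⟨B, fun x hx => hB x (by simpa using hx)⟩
  have hfar1 : ∀ a (x : EuclideanSpace ℝ (Fin k)), R + 2 < ‖x‖ →
      ‖pderiv a Q x‖ ≤ 2 * K ∧ ‖pderiv a (pderiv a Q) x‖ ≤ 2 * K + 16 * K ^ 2 := by
    intro a x hx
    have hneg : ∀ y, pderiv a (fun y => 1 - P y) y = -pderiv a P y := by
      intro y; simp [pderiv, fderiv_const_sub]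
    obtain ⟨s, hs0, hs, hb⟩ := hspec x (by linarith)
    have := norm_pderiv_kerProj_le hM hskew (hev x (by linarith)) hK0 hs0 hs a (hb a).1 (hb a).2
    have h2 : pderiv a (fun y => -pderiv a P y) x = -pderiv a (pderiv a P) x := by
      rw [pderiv, fderiv_fun_neg]; rfl
    rw [pderiv_congr (hfar x hx), pderiv_congr (pderiv_eventuallyEq (hfar x hx)), hneg,
      funext hneg, h2, norm_neg, norm_neg]
    exact this
  obtain ⟨B₁, hB₁⟩ := hbdd hQ2.continuous
  have hb₂ := fun a => hbdd (hQ2.pderiv a (m := 1) (by norm_num)).continuous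
  choose B₂ hB₂ using hb₂
  have hb₃ := fun a => hbdd ((hQ2.pderiv a (m := 1) (by norm_num)).pderiv a (m := 0)
    (by norm_num)).continuous
  choose B₃ hB₃ using hb₃
  obtain ⟨B₄, hB₄⟩ := hbdd hA2.continuous
  -- One constant for all the estimates: maxima over the ball of radius `R + 2` together with the
  -- bounds valid outside it.
  set B := |B₁| + ∑ a, |B₂ a| + ∑ a, |B₃ a| + |B₄| + 2 + 2 * K + 16 * K ^ 2 with hB
  have hp2 : 0 ≤ ∑ a, |B₂ a| := by positivity
  have hp3 : 0 ≤ ∑ a, |B₃ a| := by positivity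
  have hK2 : 0 ≤ 16 * K ^ 2 := by positivity
  have hs2 : ∀ a, B₂ a ≤ ∑ a, |B₂ a| := fun a => (le_abs_self _).trans
    (Finset.single_le_sum (f := fun a => |B₂ a|) (fun _ _ => abs_nonneg _) (Finset.mem_univ a))
  have hs3 : ∀ a, B₃ a ≤ ∑ a, |B₃ a| := fun a => (le_abs_self _).trans
    (Finset.single_le_sum (f := fun a => |B₃ a|) (fun _ _ => abs_nonneg _) (Finset.mem_univ a))
  have h1 := abs_nonneg B₁
  have h4 := abs_nonneg B₄
  have hBK : K ≤ B := by rw [hB]; linarith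
  refine ⟨Q, B, by linarith, hQ2, fun x => ?_, fun a x => ?_, fun a x => ?_, fun x => ?_,
    fun x => ?_, fun a x w => ?_⟩
  · rcases le_or_gt ‖x‖ (R + 2) with hx | hx
    · linarith [hB₁ x hx, le_abs_self B₁]
    · rw [(hfar x hx).self_of_nhds]
      have : ‖(1 : EuclideanSpace ℝ (Fin d) →L[ℝ] EuclideanSpace ℝ (Fin d)) - P x‖ ≤ 1 + 1 :=
        norm_sub_le_of_le ContinuousLinearMap.norm_id_le (norm_kerProj_le _)
      linarith
  · rcases le_or_gt ‖x‖ (R + 2) with hx | hx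
    · linarith [hB₂ a x hx, hs2 a]
    · linarith [(hfar1 a x hx).1]
  · rcases le_or_gt ‖x‖ (R + 2) with hx | hx
    · linarith [hB₃ a x hx, hs3 a]
    · linarith [(hfar1 a x hx).2]
  · rw [hAQ, hQA]
  · rw [hAQ]
    have : A x - (1 - f x) • A x = f x • A x := by ext1 w; simp [sub_smul]
    rw [this, norm_smul, Real.norm_eq_abs, abs_of_nonneg f.nonneg]
    rcases le_or_gt ‖x‖ (R + 2) with hx | hx
    · have : f x * ‖A x‖ ≤ 1 * ‖A x‖ := by gcongr; exact f.le_one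
      linarith [hB₄ x hx, le_abs_self B₄]
    · have : f x = 0 := f.zero_of_le_dist (by simpa [f] using le_of_lt hx)
      rw [this]; linarith
  -- Where `Q` is nonzero, `|∂A| ≤ K s` and `s |w - Pw| ≤ |Aw|`; the gap `s`, which may be unbounded
  -- in `x`, drops out.
  · rcases le_or_gt ‖x‖ (R + 1) with hx | hx
    · simp [hQ0 x hx]
    · obtain ⟨s, hs0, hs, hb⟩ := hspec x (by linarith)
      have hf1 : 0 ≤ 1 - f x := by linarith [f.le_one (x := x)]
      have hAQw : A x (Q x w) = (1 - f x) • A x w := by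
        rw [← mul_apply_eq_comp, hAQ]; rfl
      have hQw : Q x w = (1 - f x) • (w - P x w) := rfl
      rw [hAQw, norm_smul, Real.norm_of_nonneg hf1]
      calc ‖pderiv a A x (Q x w)‖ ≤ ‖pderiv a A x‖ * ‖Q x w‖ := ContinuousLinearMap.le_opNorm _ _
        _ ≤ (K * s) * ((1 - f x) * ‖w - P x w‖) := by
            rw [hQw, norm_smul, Real.norm_of_nonneg hf1]
            gcongr
            exact (hb a).1
        _ = K * ((1 - f x) * (s * ‖w - P x w‖)) := by ring
        _ ≤ K * ((1 - f x) * ‖A x w‖) := by gcongr; exact hs w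
        _ ≤ B * ((1 - f x) * ‖A x w‖) := by gcongr

end CutoffProjection

/-! ### Energy estimates for smooth functions of compact support -/

section Energy

variable {k : ℕ} {F : Type*} [NormedAddCommGroup F] [InnerProductSpace ℝ F]

theorem integrable_inner_of_hasCompactSupport {f g : EuclideanSpace ℝ (Fin k) → F}
    (hf : Continuous f) (hg : Continuous g) (hc : HasCompactSupport f) :
    Integrable (fun x => inner ℝ (f x) (g x)) := by
  refine (hf.inner hg).integrable_of_hasCompactSupport (hc.mono ?_)
  intro x hx h0
  simp_all

theorem integrable_norm_sq_of_hasCompactSupport {f : EuclideanSpace ℝ (Fin k) → F}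
    (hf : Continuous f) (hc : HasCompactSupport f) : Integrable (fun x => ‖f x‖ ^ 2) := by
  simpa only [real_inner_self_eq_norm_sq] using integrable_inner_of_hasCompactSupport hf hf hc

theorem integral_inner_pderiv {f g : EuclideanSpace ℝ (Fin k) → F}
    (hf : ContDiff ℝ 1 f) (hg : ContDiff ℝ 1 g) (hc : HasCompactSupport f) (a : Fin k) :
    ∫ x, inner ℝ (f x) (pderiv a g x) = -∫ x, inner ℝ (pderiv a f x) (g x) := by
  have hf' : Continuous (pderiv a f) := (hf.pderiv a (m := 0) (by norm_num)).continuous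
  have hg' : Continuous (pderiv a g) := (hg.pderiv a (m := 0) (by norm_num)).continuous
  exact integral_bilinear_fderiv_right_eq_neg_left_of_integrable
    (B := (innerSL ℝ : F →L[ℝ] F →L[ℝ] ℝ))
    (integrable_inner_of_hasCompactSupport hf' hg.continuous (hc.pderiv a))
    (integrable_inner_of_hasCompactSupport hf.continuous hg' hc)
    (integrable_inner_of_hasCompactSupport hf.continuous hg.continuous hc)
    (fun x _ => hf.differentiable (by norm_num) x)
    (fun x _ => hg.differentiable (by norm_num) x)

theorem integral_inner_pderiv_pderiv {f g : EuclideanSpace ℝ (Fin k) → F}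
    (hf : ContDiff ℝ 1 f) (hg : ContDiff ℝ 2 g) (hc : HasCompactSupport f) (a : Fin k) :
    ∫ x, inner ℝ (f x) (pderiv a (pderiv a g) x) = -∫ x, inner ℝ (pderiv a f x) (pderiv a g x) :=
  integral_inner_pderiv hf (hg.pderiv a (by norm_num)) hc a

/-- `∫ ∑ |∂_a u|² = ∫ u · (-Δu + Au)` for a skew field `A`. -/
theorem integral_norm_sq_gradient
    {A : EuclideanSpace ℝ (Fin k) → F →L[ℝ] F} {u : EuclideanSpace ℝ (Fin k) → F}
    (hinner : ∀ x, inner ℝ (u x) (A x (u x)) = 0)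
    (hu : ContDiff ℝ 2 u) (hc : HasCompactSupport u) :
    ∫ x, ∑ a, ‖pderiv a u x‖ ^ 2
      = ∫ x, inner ℝ (u x) (-(∑ a, pderiv a (pderiv a u) x) + A x (u x)) := by
  have hu1 : ∀ a, ContDiff ℝ 1 (pderiv a u) := fun a => hu.pderiv a (by norm_num)
  have hu2 : ∀ a, Continuous (pderiv a (pderiv a u)) := fun a =>
    ((hu1 a).pderiv a (m := 0) (by norm_num)).continuous
  have h1 : ∀ x, inner ℝ (u x) (-(∑ a, pderiv a (pderiv a u) x) + A x (u x))
      = -∑ a, inner ℝ (u x) (pderiv a (pderiv a u) x) := by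
    intro x
    rw [inner_add_right, hinner, inner_neg_right, inner_sum, add_zero]
  simp_rw [h1]
  rw [integral_neg, integral_finsetSum, integral_finsetSum, ← Finset.sum_neg_distrib]
  · refine Finset.sum_congr rfl fun a _ => ?_
    rw [integral_inner_pderiv_pderiv (hu.of_le (by norm_num)) hu hc, neg_neg]
    simp_rw [real_inner_self_eq_norm_sq]
  · exact fun a _ => integrable_inner_of_hasCompactSupport hu.continuous (hu2 a) hc
  · exact fun a _ => integrable_norm_sq_of_hasCompactSupport (hu1 a).continuous (hc.pderiv a)

/-- The `L²` norm of the second derivatives is that of the Laplacian. -/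
theorem integral_norm_sq_hessian {u : EuclideanSpace ℝ (Fin k) → F}
    (hu : ContDiff ℝ ∞ u) (hc : HasCompactSupport u) :
    ∑ a, ∑ b, ∫ x, ‖pderiv a (pderiv b u) x‖ ^ 2
      = ∫ x, ‖∑ a, pderiv a (pderiv a u) x‖ ^ 2 := by
  have hs : ∀ {v : EuclideanSpace ℝ (Fin k) → F}, ContDiff ℝ ∞ v → ∀ a,
      ContDiff ℝ ∞ (pderiv a v) := fun hv a => hv.pderiv a (by norm_num)
  have h1 : ∀ {v : EuclideanSpace ℝ (Fin k) → F}, ContDiff ℝ ∞ v → ContDiff ℝ 1 v :=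
    fun hv => hv.of_le (by exact_mod_cast le_top)
  have h2 : ∀ {v : EuclideanSpace ℝ (Fin k) → F}, ContDiff ℝ ∞ v → ContDiff ℝ 2 v :=
    fun hv => hv.of_le (by norm_cast)
  -- Two integrations by parts and the symmetry of third derivatives move `∂_a` onto one factor and
  -- `∂_b` onto the other.
  have key : ∀ a b, ∫ x, ‖pderiv a (pderiv b u) x‖ ^ 2
      = ∫ x, inner ℝ (pderiv a (pderiv a u) x) (pderiv b (pderiv b u) x) := by
    intro a b
    have e1 : ∀ x, pderiv a (pderiv a (pderiv b u)) x = pderiv b (pderiv a (pderiv a u)) x := by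
      intro x
      have : pderiv a (pderiv b u) = pderiv b (pderiv a u) := by
        ext1 y; exact pderiv_comm (h2 hu).contDiffAt
      rw [this]; exact pderiv_comm (h2 (hs hu a)).contDiffAt
    calc ∫ x, ‖pderiv a (pderiv b u) x‖ ^ 2
        = ∫ x, inner ℝ (pderiv a (pderiv b u) x) (pderiv a (pderiv b u) x) := by
          simp_rw [real_inner_self_eq_norm_sq]
      _ = -∫ x, inner ℝ (pderiv a (pderiv a (pderiv b u)) x) (pderiv b u x) := by
          rw [integral_inner_pderiv (h1 (hs (hs hu b) a)) (h1 (hs hu b)) ((hc.pderiv b).pderiv a)]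
      _ = -∫ x, inner ℝ (pderiv b (pderiv a (pderiv a u)) x) (pderiv b u x) := by simp_rw [e1]
      _ = _ := by
          rw [← integral_inner_pderiv (h1 (hs (hs hu a) a)) (h1 (hs hu b)) ((hc.pderiv a).pderiv a)]
  have hint : ∀ a b, Integrable
      (fun x => inner ℝ (pderiv a (pderiv a u) x) (pderiv b (pderiv b u) x)) := fun a b =>
    integrable_inner_of_hasCompactSupport (hs (hs hu a) a).continuous (hs (hs hu b) b).continuous
      ((hc.pderiv a).pderiv a)
  simp_rw [key, ← real_inner_self_eq_norm_sq, sum_inner, inner_sum]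
  rw [integral_finsetSum _ fun a _ => integrable_finsetSum _ fun b _ => hint a b]
  refine Finset.sum_congr rfl fun a _ => ?_
  rw [integral_finsetSum _ fun b _ => hint a b]

theorem integral_le_of_le_add {X : Type*} [MeasurableSpace X] {μ : Measure X} {f g h : X → ℝ}
    (hg : Integrable g μ) (hh : Integrable h μ) (hf0 : ∀ x, 0 ≤ f x) {c e : ℝ}
    (hle : ∀ x, f x ≤ c * g x + e * h x) :
    ∫ x, f x ∂μ ≤ c * ∫ x, g x ∂μ + e * ∫ x, h x ∂μ := by
  rw [← integral_const_mul, ← integral_const_mul,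
    ← integral_add (hg.const_mul c) (hh.const_mul e)]
  exact integral_mono_of_nonneg (Filter.Eventually.of_forall hf0)
    ((hg.const_mul c).add (hh.const_mul e)) (Filter.Eventually.of_forall hle)

variable {A Q : EuclideanSpace ℝ (Fin k) → F →L[ℝ] F}

theorem pderiv_pderiv_clm_apply (hQ : ContDiff ℝ 2 Q) {u : EuclideanSpace ℝ (Fin k) → F}
    (hu : ContDiff ℝ 2 u) (a : Fin k) (x : EuclideanSpace ℝ (Fin k)) :
    pderiv a (pderiv a (fun y => Q y (u y))) x = pderiv a (pderiv a Q) x (u x)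
      + (2 : ℝ) • pderiv a Q x (pderiv a u x) + Q x (pderiv a (pderiv a u) x) := by
  have hQ1 := (hQ.pderiv a (m := 1) (by norm_num)).differentiable (by norm_num)
  have hu1 := (hu.pderiv a (m := 1) (by norm_num)).differentiable (by norm_num)
  have hQ0 := hQ.differentiable (by norm_num)
  have hu0 := hu.differentiable (by norm_num)
  have : pderiv a (fun y => Q y (u y)) = fun y => pderiv a Q y (u y) + Q y (pderiv a u y) := by
    ext1 y; exact pderiv_clm_apply (hQ0 y) (hu0 y)
  rw [this, pderiv_add ((hQ1 x).clm_apply (hu0 x)) ((hQ0 x).clm_apply (hu1 x)),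
    pderiv_clm_apply (hQ1 x) (hu0 x), pderiv_clm_apply (hQ0 x) (hu1 x), two_smul]
  abel

theorem hasCompactSupport_schrodinger {u : EuclideanSpace ℝ (Fin k) → F}
    (hc : HasCompactSupport u) :
    HasCompactSupport fun x => -(∑ a, pderiv a (pderiv a u) x) + A x (u x) := by
  refine HasCompactSupport.intro hc.isCompact fun x hx => ?_
  have h0 : u =ᶠ[nhds x] fun _ => 0 := notMem_tsupport_iff_eventuallyEq.1 hx
  have h2 : ∀ a, pderiv a (pderiv a u) x = 0 := by
    intro a
    rw [pderiv_congr (pderiv_eventuallyEq h0), funext (pderiv_const a (0 : F)), pderiv_const]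
  simp [h2, h0.self_of_nhds]

/-- Pointwise form of the main estimate. The subtracted bracket is the divergence of the field with
components `⟨Av, ∂_a v⟩`, so it disappears on integration. Inserting the equation for `Δv` cancels
`|Av|²`; what remains is linear in `|Av|`, and half of `|Av|²` suffices to absorb it. -/
theorem norm_sq_apply_sub_le (hA : ContDiff ℝ 2 A)
    (hskew : ∀ x v, inner ℝ v (A x v) = 0) (hQ : ContDiff ℝ 2 Q)
    {B : ℝ} (hB : 0 ≤ B) (hQ0 : ∀ x, ‖Q x‖ ≤ B) (hQ1 : ∀ a x, ‖pderiv a Q x‖ ≤ B)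
    (hQ2 : ∀ a x, ‖pderiv a (pderiv a Q) x‖ ≤ B) (hcomm : ∀ x, Q x * A x = A x * Q x)
    (hAQ : ∀ a x w, ‖pderiv a A x (Q x w)‖ ≤ B * ‖A x (Q x w)‖)
    {u f v : EuclideanSpace ℝ (Fin k) → F} (hu : ContDiff ℝ 2 u)
    (hf : f = fun x => -(∑ a, pderiv a (pderiv a u) x) + A x (u x))
    (hv : v = fun x => Q x (u x)) {L : ℝ}
    (hL : L = B + k * B + 2 * B + B * (k * B + B)) (x : EuclideanSpace ℝ (Fin k)) :
    ‖A x (v x)‖ ^ 2 - (inner ℝ (A x (v x)) (∑ a, pderiv a (pderiv a v) x)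
      + ∑ a, inner ℝ (pderiv a (fun y => A y (v y)) x) (pderiv a v x))
      ≤ (1 / 2) * ‖A x (v x)‖ ^ 2 + (1 / 2) * (3 * L ^ 2 * (k + 1)) *
        (‖f x‖ ^ 2 + ‖u x‖ ^ 2 + ∑ a, ‖pderiv a u x‖ ^ 2) := by
  have hv2 : ContDiff ℝ 2 v := hv ▸ hQ.clm_apply hu
  -- Apply `Q` to the equation for `u`: commutation turns `Q A u` into `A v`, and the sum collects
  -- the commutator of `Δ` with `Q`.
  have hlap : ∑ a, pderiv a (pderiv a v) x = (A x (v x) - Q x (f x))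
      + ∑ a, (pderiv a (pderiv a Q) x (u x) + (2 : ℝ) • pderiv a Q x (pderiv a u x)) := by
    have hcx : Q x (A x (u x)) = A x (Q x (u x)) := DFunLike.congr_fun (hcomm x) (u x)
    simp only [hf, map_add, map_neg, map_sum, hcx, hv]
    simp_rw [pderiv_pderiv_clm_apply hQ hu]
    rw [Finset.sum_add_distrib]
    abel
  set σ := fun x => ∑ a, ‖pderiv a u x‖ with hσ
  set N := fun x => ‖f x‖ ^ 2 + ‖u x‖ ^ 2 + ∑ a, ‖pderiv a u x‖ ^ 2 with hN
  change _ ≤ _ + _ * N x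
  -- Skewness eliminates `⟨A ∂v, ∂v⟩`; only the derivative of `A`, acting on `v`, survives.
  have hpa : ∀ a, inner ℝ (pderiv a (fun y => A y (v y)) x) (pderiv a v x)
      = inner ℝ (pderiv a A x (v x)) (pderiv a v x) := by
    intro a
    rw [pderiv_clm_apply (hA.differentiable (by norm_num) x)
      (hv2.differentiable (by norm_num) x), inner_add_left, real_inner_comm _ (A x _), hskew,
      add_zero]
  have hb1 : ∀ a, -inner ℝ (pderiv a A x (v x)) (pderiv a v x)
      ≤ ‖A x (v x)‖ * (B * (B * ‖u x‖ + B * ‖pderiv a u x‖)) := by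
    intro a
    have e1 : ‖pderiv a v x‖ ≤ B * ‖u x‖ + B * ‖pderiv a u x‖ := by
      rw [hv, pderiv_clm_apply (hQ.differentiable (by norm_num) x)
        (hu.differentiable (by norm_num) x)]
      refine norm_add_le_of_le ?_ ?_
      · exact (ContinuousLinearMap.le_opNorm _ _).trans (by gcongr; exact hQ1 a x)
      · exact (ContinuousLinearMap.le_opNorm _ _).trans (by gcongr; exact hQ0 x)
    calc -inner ℝ (pderiv a A x (v x)) (pderiv a v x)
        ≤ ‖pderiv a A x (v x)‖ * ‖pderiv a v x‖ :=
          (neg_le_abs _).trans (abs_real_inner_le_norm _ _)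
      _ ≤ (B * ‖A x (v x)‖) * (B * ‖u x‖ + B * ‖pderiv a u x‖) := by
          gcongr; rw [hv]; exact hAQ a x (u x)
      _ = _ := by ring
  have hb2 : -∑ a, inner ℝ (pderiv a A x (v x)) (pderiv a v x)
      ≤ ‖A x (v x)‖ * (B * (k * B * ‖u x‖ + B * σ x)) := by
    rw [← Finset.sum_neg_distrib]
    refine (Finset.sum_le_sum fun a _ => hb1 a).trans (le_of_eq ?_)
    simp only [← Finset.mul_sum, Finset.sum_add_distrib,
      Finset.sum_const, Finset.card_univ, Fintype.card_fin, nsmul_eq_mul, hσ]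
    ring
  have hb3 : -inner ℝ (A x (v x)) (-(Q x (f x)) +
      ∑ a, (pderiv a (pderiv a Q) x (u x) + (2 : ℝ) • pderiv a Q x (pderiv a u x)))
      ≤ ‖A x (v x)‖ * (B * ‖f x‖ + (k * B * ‖u x‖ + 2 * B * σ x)) := by
    refine (neg_le_abs _).trans ((abs_real_inner_le_norm _ _).trans ?_)
    gcongr
    refine norm_add_le_of_le ?_ ?_
    · rw [norm_neg]
      exact (ContinuousLinearMap.le_opNorm _ _).trans (by gcongr; exact hQ0 x)
    · have : ∀ a ∈ Finset.univ,
          ‖pderiv a (pderiv a Q) x (u x) + (2 : ℝ) • pderiv a Q x (pderiv a u x)‖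
          ≤ B * ‖u x‖ + 2 * B * ‖pderiv a u x‖ := by
        intro a _
        refine norm_add_le_of_le ?_ ?_
        · exact (ContinuousLinearMap.le_opNorm _ _).trans (by gcongr; exact hQ2 a x)
        · rw [norm_smul, Real.norm_ofNat, mul_assoc]
          gcongr
          exact (ContinuousLinearMap.le_opNorm _ _).trans (by gcongr; exact hQ1 a x)
      refine (norm_sum_le_of_le _ this).trans (le_of_eq ?_)
      simp only [← Finset.mul_sum, Finset.sum_add_distrib,
        Finset.sum_const, Finset.card_univ, Fintype.card_fin, nsmul_eq_mul, hσ]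
      ring
  have hσ0 : 0 ≤ σ x := Finset.sum_nonneg fun a _ => norm_nonneg _
  have hσ2 : σ x ^ 2 ≤ k * ∑ a, ‖pderiv a u x‖ ^ 2 := by
    have := sq_sum_le_card_mul_sum_sq (s := Finset.univ) (f := fun a => ‖pderiv a u x‖)
    simpa using this
  have hS0 : 0 ≤ ∑ a, ‖pderiv a u x‖ ^ 2 := by positivity
  have hT : (B * ‖f x‖ + (k * B * ‖u x‖ + 2 * B * σ x)) + B * (k * B * ‖u x‖ + B * σ x)
      ≤ L * (‖f x‖ + ‖u x‖ + σ x) := by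
    have hk : (0 : ℝ) ≤ k := Nat.cast_nonneg k
    have d1 := mul_nonneg hB hB
    have d2 := mul_nonneg hk hB
    have d3 := mul_nonneg hk d1
    have c1 : B ≤ L := by rw [hL]; nlinarith
    have c2 : k * B + B * (k * B) ≤ L := by rw [hL]; nlinarith
    have c3 : 2 * B + B * B ≤ L := by rw [hL]; nlinarith
    calc _ = B * ‖f x‖ + (k * B + B * (k * B)) * ‖u x‖ + (2 * B + B * B) * σ x := by ring
      _ ≤ L * ‖f x‖ + L * ‖u x‖ + L * σ x := by gcongr
      _ = _ := by ring
  -- The 3 comes from squaring a sum of three terms, and `k + 1` from Cauchy–Schwarz on the `k`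
  -- terms of `σ`.
  have hsq : (‖f x‖ + ‖u x‖ + σ x) ^ 2 ≤ 3 * (k + 1) * N x := by
    have hk : (0 : ℝ) ≤ k := Nat.cast_nonneg k
    have c : (‖f x‖ + ‖u x‖ + σ x) ^ 2 ≤ 3 * (‖f x‖ ^ 2 + ‖u x‖ ^ 2 + σ x ^ 2) := by
      nlinarith [sq_nonneg (‖f x‖ - ‖u x‖), sq_nonneg (‖f x‖ - σ x), sq_nonneg (‖u x‖ - σ x)]
    have c2 : 0 ≤ k * (‖f x‖ ^ 2 + ‖u x‖ ^ 2) := by positivity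
    simp only [hN]
    nlinarith
  set W := ‖A x (v x)‖ with hW
  have hW0 : 0 ≤ W := norm_nonneg _
  have hWL : W * (L * (‖f x‖ + ‖u x‖ + σ x)) ≤
      (1 / 2) * W ^ 2 + (1 / 2) * (3 * L ^ 2 * (k + 1)) * N x := by
    have c := sq_nonneg (W - L * (‖f x‖ + ‖u x‖ + σ x))
    have c2 : L ^ 2 * (‖f x‖ + ‖u x‖ + σ x) ^ 2 ≤ L ^ 2 * (3 * (k + 1) * N x) := by gcongr
    nlinarith
  refine le_trans ?_ hWL
  refine le_trans ?_ (mul_le_mul_of_nonneg_left hT hW0)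
  rw [mul_add]
  refine le_trans (le_of_eq ?_) (add_le_add hb3 hb2)
  rw [hlap, Finset.sum_congr rfl (fun a _ => hpa a), sub_eq_add_neg (A x (v x)), add_assoc,
    inner_add_right, real_inner_self_eq_norm_sq]
  ring

/-- The a priori bound of `A Q u` by `-Δu + Au` for a skew field `A` commuting with `Q`. -/
theorem integral_norm_sq_apply_le (hA : ContDiff ℝ 2 A)
    (hskew : ∀ x v, inner ℝ v (A x v) = 0) (hQ : ContDiff ℝ 2 Q)
    {B : ℝ} (hB : 0 ≤ B) (hQ0 : ∀ x, ‖Q x‖ ≤ B) (hQ1 : ∀ a x, ‖pderiv a Q x‖ ≤ B)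
    (hQ2 : ∀ a x, ‖pderiv a (pderiv a Q) x‖ ≤ B) (hcomm : ∀ x, Q x * A x = A x * Q x)
    (hAQ : ∀ a x w, ‖pderiv a A x (Q x w)‖ ≤ B * ‖A x (Q x w)‖)
    {u : EuclideanSpace ℝ (Fin k) → F} (hu : ContDiff ℝ 2 u) (hc : HasCompactSupport u) :
    ∫ x, ‖A x (Q x (u x))‖ ^ 2 ≤
      3 * (B + k * B + 2 * B + B * (k * B + B)) ^ 2 * (k + 1) *
      ∫ x, (‖-(∑ a, pderiv a (pderiv a u) x) + A x (u x)‖ ^ 2 + ‖u x‖ ^ 2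
        + ∑ a, ‖pderiv a u x‖ ^ 2) := by
  set f := fun x => -(∑ a, pderiv a (pderiv a u) x) + A x (u x) with hf
  set v := fun x => Q x (u x) with hv
  set L := B + k * B + 2 * B + B * (k * B + B) with hL
  have hL0 : 0 ≤ L := by positivity
  have hv2 : ContDiff ℝ 2 v := hQ.clm_apply hu
  have hvc : HasCompactSupport v := hc.mono fun x hx h0 => hx (by simp_all)
  have hw2 : ContDiff ℝ 2 (fun x => A x (v x)) := hA.clm_apply hv2
  have hwc : HasCompactSupport (fun x => A x (v x)) := hvc.mono fun x hx h0 => hx (by simp_all)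
  have hu1 : ∀ a, ContDiff ℝ 1 (pderiv a u) := fun a => hu.pderiv a (by norm_num)
  have hu2 : ∀ a, Continuous (pderiv a (pderiv a u)) := fun a =>
    ((hu1 a).pderiv a (m := 0) (by norm_num)).continuous
  have hv1 : ∀ a, ContDiff ℝ 1 (pderiv a v) := fun a => hv2.pderiv a (by norm_num)
  have hvv : ∀ a, Continuous (pderiv a (pderiv a v)) := fun a =>
    ((hv1 a).pderiv a (m := 0) (by norm_num)).continuous
  have hA1 : ∀ a, Continuous (pderiv a A) := fun a =>
    (hA.pderiv a (m := 1) (by norm_num)).continuous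
  have hfc : HasCompactSupport f := hasCompactSupport_schrodinger hc
  have hfcont : Continuous f :=
    (continuous_finsetSum _ fun a _ => hu2 a).neg.add (hA.continuous.clm_apply hu.continuous)
  set N := fun x => ‖f x‖ ^ 2 + ‖u x‖ ^ 2 + ∑ a, ‖pderiv a u x‖ ^ 2 with hN
  have hNint : Integrable N :=
    ((integrable_norm_sq_of_hasCompactSupport hfcont hfc).add
      (integrable_norm_sq_of_hasCompactSupport hu.continuous hc)).add
      (integrable_finsetSum _ fun a _ =>
        integrable_norm_sq_of_hasCompactSupport (hu1 a).continuous (hc.pderiv a))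
  have hwint := integrable_norm_sq_of_hasCompactSupport hw2.continuous hwc
  have hpt := norm_sq_apply_sub_le hA hskew hQ hB hQ0 hQ1 hQ2 hcomm hAQ hu hf hv hL
  have hzero : ∫ x, (inner ℝ (A x (v x)) (∑ a, pderiv a (pderiv a v) x)
      + ∑ a, inner ℝ (pderiv a (fun y => A y (v y)) x) (pderiv a v x)) = 0 := by
    have i1 : ∀ a, Integrable (fun x => inner ℝ (A x (v x)) (pderiv a (pderiv a v) x)) := fun a =>
      integrable_inner_of_hasCompactSupport hw2.continuous (hvv a) hwc
    have i2 : ∀ a, Integrable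
        (fun x => inner ℝ (pderiv a (fun y => A y (v y)) x) (pderiv a v x)) := fun a =>
      integrable_inner_of_hasCompactSupport (hw2.pderiv a (m := 1) (by norm_num)).continuous
        (hv1 a).continuous (hwc.pderiv a)
    simp_rw [inner_sum]
    rw [integral_add (integrable_finsetSum _ fun a _ => i1 a)
      (integrable_finsetSum _ fun a _ => i2 a), integral_finsetSum _ fun a _ => i1 a,
      integral_finsetSum _ fun a _ => i2 a, ← Finset.sum_add_distrib]
    refine Finset.sum_eq_zero fun a _ => ?_
    rw [integral_inner_pderiv_pderiv (hw2.of_le (by norm_num)) hv2 hwc]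
    ring
  have hzint : Integrable (fun x => inner ℝ (A x (v x)) (∑ a, pderiv a (pderiv a v) x)
      + ∑ a, inner ℝ (pderiv a (fun y => A y (v y)) x) (pderiv a v x)) :=
    (integrable_inner_of_hasCompactSupport hw2.continuous
      (continuous_finsetSum _ fun a _ => hvv a) hwc).add
    (integrable_finsetSum _ fun a _ =>
      integrable_inner_of_hasCompactSupport (hw2.pderiv a (m := 1) (by norm_num)).continuous
        (hv1 a).continuous (hwc.pderiv a))
  have hfin := integral_mono (hwint.sub hzint)
    ((hwint.const_mul (1 / 2)).add (hNint.const_mul ((1 / 2) * (3 * L ^ 2 * (k + 1))))) hpt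
  simp only [Pi.sub_apply, Pi.add_apply] at hfin
  rw [integral_sub hwint hzint, hzero, integral_add (hwint.const_mul _) (hNint.const_mul _),
    integral_const_mul, integral_const_mul] at hfin
  linarith

end Energy

/-! ### The a priori estimate for the Schrödinger operator -/

section Apriori

variable {k d : ℕ} {M : EuclideanSpace ℝ (Fin k) → Matrix (Fin d) (Fin d) ℝ}

theorem schrodinger_eq {u : EuclideanSpace ℝ (Fin k) → EuclideanSpace ℝ (Fin d)}
    (hu : ContDiff ℝ ∞ u) (x : EuclideanSpace ℝ (Fin k)) :
    -(Δ u) x + mulField M u x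
      = -(∑ a, pderiv a (pderiv a u) x) + opField M x (u x) := by
  rw [laplacian_eq_sum_pderiv (hu.contDiffAt.of_le (by norm_cast)), mulField_apply]

theorem contDiff_pderiv {G : Type*} [NormedAddCommGroup G] [NormedSpace ℝ G]
    {u : EuclideanSpace ℝ (Fin k) → G}
    (hu : ContDiff ℝ ∞ u) (a : Fin k) : ContDiff ℝ ∞ (pderiv a u) := hu.pderiv a (by norm_num)

theorem continuous_mulField (hM : ∀ i j, ContDiff ℝ 2 (fun x => M x i j))
    {u : EuclideanSpace ℝ (Fin k) → EuclideanSpace ℝ (Fin d)} (hu : Continuous u) :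
    Continuous (mulField M u) :=
  (contDiff_opField hM).continuous.clm_apply hu

theorem continuous_schrodinger (hM : ∀ i j, ContDiff ℝ 2 (fun x => M x i j))
    {u : EuclideanSpace ℝ (Fin k) → EuclideanSpace ℝ (Fin d)} (hu : ContDiff ℝ ∞ u) :
    Continuous fun x => -(Δ u) x + mulField M u x := by
  simp_rw [schrodinger_eq hu]
  exact (continuous_finsetSum _ fun a _ => (contDiff_pderiv (contDiff_pderiv hu a) a).continuous).neg.add
    (continuous_mulField hM hu.continuous)

theorem hasCompactSupport_neg_laplacian_add
    {u : EuclideanSpace ℝ (Fin k) → EuclideanSpace ℝ (Fin d)} (hu : ContDiff ℝ ∞ u)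
    (hc : HasCompactSupport u) : HasCompactSupport fun x => -(Δ u) x + mulField M u x := by
  simp_rw [schrodinger_eq hu]
  exact hasCompactSupport_schrodinger hc

theorem hasCompactSupport_mulField {u : EuclideanSpace ℝ (Fin k) → EuclideanSpace ℝ (Fin d)}
    (hc : HasCompactSupport u) : HasCompactSupport (mulField M u) :=
  hc.mono fun x hx h0 => hx (by simp [mulField_apply, h0])

set_option maxHeartbeats 1000000 in
/-- The derivatives of order one and two of a test function `u`, and `Mu`, are controlled in `L²` by
`u` and `-Δu + Mu`. -/
theorem exists_apriori_bound (hM : ∀ i j, ContDiff ℝ 2 (fun x => M x i j))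
    (hskew : ∀ x, (M x)ᵀ = -M x) {C R : ℝ} (hC : 0 < C) {m : ℕ}
    (hder : ∀ x : EuclideanSpace ℝ (Fin k), R ≤ ‖x‖ → ∀ (i j : Fin d) (n : ℕ), 1 ≤ n → n ≤ 2 →
      ∀ a : Fin n → Fin k, ENNReal.ofReal |partialDeriv a (fun y => M y i j) x|
        ≤ ENNReal.ofReal C * minNonzeroEigenvalueModulus (M x))
    (hm : ∀ x : EuclideanSpace ℝ (Fin k), R ≤ ‖x‖ → dimKer (M x) = m) (hR : 0 < R) :
    ∃ K : ℝ, 0 ≤ K ∧ ∀ u : EuclideanSpace ℝ (Fin k) → EuclideanSpace ℝ (Fin d),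
      ContDiff ℝ ∞ u → HasCompactSupport u →
      (∀ a, ∫ x, ‖pderiv a u x‖ ^ 2
        ≤ K * ((∫ x, ‖u x‖ ^ 2) + ∫ x, ‖-(Δ u) x + mulField M u x‖ ^ 2)) ∧
      (∀ a b, ∫ x, ‖pderiv a (pderiv b u) x‖ ^ 2
        ≤ K * ((∫ x, ‖u x‖ ^ 2) + ∫ x, ‖-(Δ u) x + mulField M u x‖ ^ 2)) ∧
      ∫ x, ‖mulField M u x‖ ^ 2
        ≤ K * ((∫ x, ‖u x‖ ^ 2) + ∫ x, ‖-(Δ u) x + mulField M u x‖ ^ 2) := by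
  obtain ⟨Q, B, hB, hQ, hQ0, hQ1, hQ2, hcomm, hdiff, hAQ⟩ :=
    exists_cutoff_projection hM hskew hC hder hm hR
  have hskew' : ∀ x v, inner ℝ v (opField M x v) = 0 := fun x v =>
    inner_skew_self (adjoint_opField hskew x) v
  set L := 3 * (B + k * B + 2 * B + B * (k * B + B)) ^ 2 * (k + 1) with hL
  have hL0 : 0 ≤ L := by positivity
  set K₁ := 2 * (2 * L) + 2 * B ^ 2 with hK₁
  have hK₁0 : 0 ≤ K₁ := by positivity
  refine ⟨1 + (2 + 2 * K₁), by positivity, fun u hu hc => ?_⟩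
  set f := fun x => -(Δ u) x + mulField M u x with hf
  have hfeq : ∀ x, f x = -(∑ a, pderiv a (pderiv a u) x) + opField M x (u x) := schrodinger_eq hu
  have hu2 : ContDiff ℝ 2 u := hu.of_le (by norm_cast)
  have iu := integrable_norm_sq_of_hasCompactSupport hu.continuous hc
  have hfc : Continuous f := continuous_schrodinger hM hu
  have hfs : HasCompactSupport f := hasCompactSupport_neg_laplacian_add hu hc
  have i_f := integrable_norm_sq_of_hasCompactSupport hfc hfs
  have ig : ∀ a, Integrable (fun x => ‖pderiv a u x‖ ^ 2) := fun a =>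
    integrable_norm_sq_of_hasCompactSupport (contDiff_pderiv hu a).continuous (hc.pderiv a)
  have iM := integrable_norm_sq_of_hasCompactSupport (continuous_mulField hM hu.continuous)
    (hasCompactSupport_mulField (M := M) hc)
  set U := ∫ x, ‖u x‖ ^ 2 with hU
  set W := ∫ x, ‖f x‖ ^ 2 with hW
  have hU0 : 0 ≤ U := integral_nonneg fun x => by positivity
  have hW0 : 0 ≤ W := integral_nonneg fun x => by positivity
  have hgrad : ∫ x, ∑ a, ‖pderiv a u x‖ ^ 2 ≤ U + W := by
    rw [integral_norm_sq_gradient (fun x => hskew' x (u x)) hu2 hc]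
    simp_rw [← hfeq]
    have hi := integrable_inner_of_hasCompactSupport hu.continuous hfc hc
    rw [hU, hW, ← integral_add iu i_f]
    refine integral_mono hi (iu.add i_f) fun x => ?_
    have h1 := real_inner_le_norm (u x) (f x)
    change inner ℝ (u x) (f x) ≤ ‖u x‖ ^ 2 + ‖f x‖ ^ 2
    nlinarith [sq_nonneg (‖u x‖ - ‖f x‖), sq_nonneg (‖u x‖), sq_nonneg (‖f x‖)]
  have hAQu : ∫ x, ‖opField M x (Q x (u x))‖ ^ 2 ≤ 2 * L * (U + W) := by
    refine (integral_norm_sq_apply_le (contDiff_opField hM) hskew' hQ hB hQ0 hQ1 hQ2 hcomm hAQ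
      hu2 hc).trans ?_
    simp_rw [← hfeq]
    have h1 : ∫ x, (‖f x‖ ^ 2 + ‖u x‖ ^ 2 + ∑ a, ‖pderiv a u x‖ ^ 2)
        = W + U + ∫ x, ∑ a, ‖pderiv a u x‖ ^ 2 := by
      rw [hW, hU, ← integral_add i_f iu]
      exact integral_add (i_f.add iu) (integrable_finsetSum _ fun a _ => ig a)
    rw [h1]
    nlinarith
  -- Split `M u` into `M Q u`, bounded by the main estimate, and `(M - M Q) u`, bounded pointwise by
  -- `B |u|`.
  have hMu : ∫ x, ‖mulField M u x‖ ^ 2 ≤ K₁ * (U + W) := by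
    have iAQ : Integrable (fun x => ‖opField M x (Q x (u x))‖ ^ 2) :=
      integrable_norm_sq_of_hasCompactSupport
        ((contDiff_opField hM).continuous.clm_apply (hQ.continuous.clm_apply hu.continuous))
        (hc.mono fun x hx h0 => hx (by simp [h0]))
    have := integral_le_of_le_add (f := fun x => ‖mulField M u x‖ ^ 2) iAQ iu
      (fun x => by positivity) (c := 2) (e := 2 * B ^ 2) fun x => by
        have h1 : ‖mulField M u x‖ ≤ ‖opField M x (Q x (u x))‖ + B * ‖u x‖ := by
          have : mulField M u x = opField M x (Q x (u x))
              + (opField M x - opField M x * Q x) (u x) := by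
            rw [mulField_apply]; simp
          rw [this]
          refine norm_add_le_of_le le_rfl ?_
          exact (ContinuousLinearMap.le_opNorm _ _).trans (by gcongr; exact hdiff x)
        have h2 : ‖mulField M u x‖ ^ 2 ≤ (‖opField M x (Q x (u x))‖ + B * ‖u x‖) ^ 2 := by gcongr
        nlinarith [sq_nonneg (‖opField M x (Q x (u x))‖ - B * ‖u x‖)]
    rw [hK₁]
    nlinarith
  have hhess : ∫ x, ‖∑ a, pderiv a (pderiv a u) x‖ ^ 2 ≤ (2 + 2 * K₁) * (U + W) := by
    have := integral_le_of_le_add (f := fun x => ‖∑ a, pderiv a (pderiv a u) x‖ ^ 2) i_f iM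
      (fun x => by positivity) (c := 2) (e := 2) fun x => by
        have h1 : ‖∑ a, pderiv a (pderiv a u) x‖ ≤ ‖f x‖ + ‖mulField M u x‖ := by
          have : ∑ a, pderiv a (pderiv a u) x = -f x + mulField M u x := by
            rw [hfeq, mulField_apply]; abel
          rw [this]
          exact norm_add_le_of_le (norm_neg _).le le_rfl
        have h2 : ‖∑ a, pderiv a (pderiv a u) x‖ ^ 2 ≤ (‖f x‖ + ‖mulField M u x‖) ^ 2 := by gcongr
        nlinarith [sq_nonneg (‖f x‖ - ‖mulField M u x‖)]
    nlinarith
  have hUW : 0 ≤ U + W := by positivity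
  have hK₁U : 0 ≤ K₁ * (U + W) := by positivity
  have e₁ : (1 + (2 + 2 * K₁)) * (U + W) = 3 * (U + W) + 2 * (K₁ * (U + W)) := by ring
  have e₂ : (2 + 2 * K₁) * (U + W) = 2 * (U + W) + 2 * (K₁ * (U + W)) := by ring
  rw [e₂] at hhess
  rw [e₁]
  refine ⟨fun a => ?_, fun a b => ?_, ?_⟩
  · have : ∫ x, ‖pderiv a u x‖ ^ 2 ≤ ∫ x, ∑ a, ‖pderiv a u x‖ ^ 2 :=
      integral_mono (ig a) (integrable_finsetSum _ fun a _ => ig a) fun x =>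
        Finset.single_le_sum (f := fun a => ‖pderiv a u x‖ ^ 2) (fun _ _ => by positivity)
          (Finset.mem_univ a)
    linarith
  · have h0 : ∀ a b, 0 ≤ ∫ x, ‖pderiv a (pderiv b u) x‖ ^ 2 := fun a b =>
      integral_nonneg fun x => by positivity
    have h1 : ∫ x, ‖pderiv a (pderiv b u) x‖ ^ 2 ≤ ∫ x, ‖∑ a, pderiv a (pderiv a u) x‖ ^ 2 := by
      rw [← integral_norm_sq_hessian hu hc]
      refine (Finset.single_le_sum (f := fun b => ∫ x, ‖pderiv a (pderiv b u) x‖ ^ 2)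
        (fun b _ => h0 a b) (Finset.mem_univ b)).trans ?_
      exact Finset.single_le_sum (f := fun a => ∑ b, ∫ x, ‖pderiv a (pderiv b u) x‖ ^ 2)
        (fun a _ => Finset.sum_nonneg fun b _ => h0 a b) (Finset.mem_univ a)
    linarith
  · linarith

end Apriori

/-! ### Passage to the closure -/

section Closure

open Filter Topology

variable {k d : ℕ} {M : EuclideanSpace ℝ (Fin k) → Matrix (Fin d) (Fin d) ℝ}

theorem norm_sq_eq_integral (g : L2Field k d) : ‖g‖ ^ 2 = ∫ x, ‖g x‖ ^ 2 := by
  rw [← real_inner_self_eq_norm_sq, L2.inner_def]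
  simp_rw [real_inner_self_eq_norm_sq]

theorem norm_sq_eq_integral_of_ae {g : L2Field k d}
    {f : EuclideanSpace ℝ (Fin k) → EuclideanSpace ℝ (Fin d)} (h : g =ᵐ[volume] f) :
    ‖g‖ ^ 2 = ∫ x, ‖f x‖ ^ 2 := by
  rw [norm_sq_eq_integral]
  refine integral_congr_ae ?_
  filter_upwards [h] with x hx
  rw [hx]

theorem memLp_of_hasCompactSupport {G : Type*} [NormedAddCommGroup G] {p : ℝ≥0∞}
    {f : EuclideanSpace ℝ (Fin k) → G} (hf : Continuous f) (hc : HasCompactSupport f) :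
    MemLp f p :=
  hf.memLp_of_hasCompactSupport hc

/-- An operation on test functions that is bounded in `L²` by the graph norm of `-Δ + M` converges
along sequences that converge in the graph norm. -/
theorem exists_tendsto_of_bound
    (Θ : (EuclideanSpace ℝ (Fin k) → EuclideanSpace ℝ (Fin d)) →
      EuclideanSpace ℝ (Fin k) → EuclideanSpace ℝ (Fin d))
    (hsub : ∀ φ ψ, ContDiff ℝ ∞ φ → ContDiff ℝ ∞ ψ → Θ (φ - ψ) = Θ φ - Θ ψ) {K : ℝ} (hK : 0 ≤ K)
    (hbd : ∀ φ, ContDiff ℝ ∞ φ → HasCompactSupport φ →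
      ∫ x, ‖Θ φ x‖ ^ 2 ≤ K * ((∫ x, ‖φ x‖ ^ 2) + ∫ x, ‖-(Δ φ) x + mulField M φ x‖ ^ 2))
    {φ : ℕ → EuclideanSpace ℝ (Fin k) → EuclideanSpace ℝ (Fin d)}
    (hφ : ∀ n, ContDiff ℝ ∞ (φ n)) (hc : ∀ n, HasCompactSupport (φ n))
    {p : ℕ → L2Field k d × L2Field k d} {q : L2Field k d × L2Field k d}
    (hp : Tendsto p atTop (𝓝 q)) (h1 : ∀ n, (p n).1 =ᵐ[volume] φ n)
    (h2 : ∀ n, (p n).2 =ᵐ[volume] fun x => -(Δ (φ n)) x + mulField M (φ n) x)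
    (hΘ : ∀ n, MemLp (Θ (φ n)) 2) :
    ∃ t : L2Field k d, Tendsto (fun n => (hΘ n).toLp) atTop (𝓝 t) := by
  refine cauchySeq_tendsto_of_complete (Metric.cauchySeq_iff.2 fun ε hε => ?_)
  -- The product carries the maximum norm, which dominates each component; hence the factor 2 under
  -- the root.
  have hle : ∀ m n, dist (hΘ m).toLp (hΘ n).toLp ≤ √(2 * K) * dist (p m) (p n) := by
    intro m n
    rw [dist_eq_norm, dist_eq_norm]
    refine le_of_sq_le_sq ?_ (by positivity)
    rw [mul_pow, Real.sq_sqrt (by positivity)]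
    have e1 : ‖(p m).1 - (p n).1‖ ^ 2 = ∫ x, ‖(φ m - φ n) x‖ ^ 2 := by
      refine norm_sq_eq_integral_of_ae ?_
      filter_upwards [Lp.coeFn_sub (p m).1 (p n).1, h1 m, h1 n] with x hx hm hn
      rw [hx, Pi.sub_apply, Pi.sub_apply, hm, hn]
    have e2 : ‖(p m).2 - (p n).2‖ ^ 2
        = ∫ x, ‖-(Δ (φ m - φ n)) x + mulField M (φ m - φ n) x‖ ^ 2 := by
      refine norm_sq_eq_integral_of_ae ?_
      filter_upwards [Lp.coeFn_sub (p m).2 (p n).2, h2 m, h2 n] with x hx hm hn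
      rw [hx, Pi.sub_apply, hm, hn, ContDiffAt.laplacian_sub ((hφ m).contDiffAt.of_le (by norm_cast))
        ((hφ n).contDiffAt.of_le (by norm_cast)), mulField_apply, mulField_apply, mulField_apply,
        Pi.sub_apply, map_sub]
      abel
    have e3 : ‖(hΘ m).toLp - (hΘ n).toLp‖ ^ 2 = ∫ x, ‖Θ (φ m - φ n) x‖ ^ 2 := by
      refine norm_sq_eq_integral_of_ae ?_
      rw [← MemLp.toLp_sub, hsub _ _ (hφ m) (hφ n)]
      exact MemLp.coeFn_toLp _
    rw [e3]
    refine (hbd (φ m - φ n) ((hφ m).sub (hφ n)) ((hc m).sub (hc n))).trans ?_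
    rw [← e1, ← e2]
    have f1 : ‖(p m).1 - (p n).1‖ ≤ ‖p m - p n‖ := norm_fst_le (p m - p n)
    have f2 : ‖(p m).2 - (p n).2‖ ≤ ‖p m - p n‖ := norm_snd_le (p m - p n)
    calc K * (‖(p m).1 - (p n).1‖ ^ 2 + ‖(p m).2 - (p n).2‖ ^ 2)
        ≤ K * (‖p m - p n‖ ^ 2 + ‖p m - p n‖ ^ 2) := by gcongr
      _ = _ := by ring
  -- The added 1 keeps the denominator positive when `K = 0`.
  obtain ⟨N, hN⟩ := Metric.cauchySeq_iff.1 hp.cauchySeq (ε / (√(2 * K) + 1)) (by positivity)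
  refine ⟨N, fun m hm n hn => (hle m n).trans_lt ?_⟩
  have := hN m hm n hn
  rw [lt_div_iff₀ (by positivity)] at this
  nlinarith [dist_nonneg (x := p m) (y := p n)]

/-- Integration against a test function is continuous on `L²`. -/
theorem tendsto_integral_smul {ψ : EuclideanSpace ℝ (Fin k) → ℝ} (hψ : Continuous ψ)
    (hc : HasCompactSupport ψ) {T : ℕ → L2Field k d} {t : L2Field k d}
    (hT : Tendsto T atTop (𝓝 t)) :
    Tendsto (fun n => ∫ x, ψ x • T n x) atTop (𝓝 (∫ x, ψ x • t x)) := by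
  have hψ2 : MemLp ψ 2 := memLp_of_hasCompactSupport hψ hc
  have key : ∀ g : L2Field k d, (ContinuousLinearMap.lsmul ℝ ℝ :
      ℝ →L[ℝ] EuclideanSpace ℝ (Fin d) →L[ℝ] EuclideanSpace ℝ (Fin d)).lpPairing volume 2 2
        hψ2.toLp g = ∫ x, ψ x • g x := by
    intro g
    rw [ContinuousLinearMap.lpPairing_eq_integral]
    refine integral_congr_ae ?_
    filter_upwards [hψ2.coeFn_toLp] with x hx
    rw [hx]; rfl
  simp_rw [← key]
  exact ((ContinuousLinearMap.continuous _).tendsto t).comp hT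

theorem integral_smul_congr {ψ : EuclideanSpace ℝ (Fin k) → ℝ}
    {f g : EuclideanSpace ℝ (Fin k) → EuclideanSpace ℝ (Fin d)} (h : f =ᵐ[volume] g) :
    ∫ x, ψ x • f x = ∫ x, ψ x • g x := by
  refine integral_congr_ae ?_
  filter_upwards [h] with x hx
  rw [hx]

theorem isWeakPartialDeriv_pderiv {f : EuclideanSpace ℝ (Fin k) → EuclideanSpace ℝ (Fin d)}
    (hf : ContDiff ℝ ∞ f) (a : Fin k) : IsWeakPartialDeriv a f (pderiv a f) := by
  intro φ hφ hc
  have hφ' : Continuous (pderiv a φ) := (contDiff_pderiv hφ a).continuous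
  have hf' : Continuous (pderiv a f) := (contDiff_pderiv hf a).continuous
  have h := integral_smul_fderiv_eq_neg_fderiv_smul_of_integrable (μ := volume) (f := φ) (g := f)
    (v := EuclideanSpace.single a (1 : ℝ))
    ((hφ'.smul hf.continuous).integrable_of_hasCompactSupport
      ((hc.pderiv a).smul_right))
    ((hφ.continuous.smul hf').integrable_of_hasCompactSupport hc.smul_right)
    ((hφ.continuous.smul hf.continuous).integrable_of_hasCompactSupport hc.smul_right)
    (fun x _ => hφ.differentiable (by simp) x) (fun x _ => hf.differentiable (by simp) x)
  change _ = -∫ x, φ x • fderiv ℝ f x (EuclideanSpace.single a (1 : ℝ))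
  rw [h, neg_neg]

theorem isWeakPartialDeriv_of_tendsto {a : Fin k}
    {f g : ℕ → EuclideanSpace ℝ (Fin k) → EuclideanSpace ℝ (Fin d)}
    (hfg : ∀ n, IsWeakPartialDeriv a (f n) (g n)) {S T : ℕ → L2Field k d} {s t : L2Field k d}
    (hS : Tendsto S atTop (𝓝 s)) (hT : Tendsto T atTop (𝓝 t)) (hSf : ∀ n, S n =ᵐ[volume] f n)
    (hTg : ∀ n, T n =ᵐ[volume] g n) : IsWeakPartialDeriv a s t := by
  intro φ hφ hc
  have h1 := tendsto_integral_smul (contDiff_pderiv hφ a).continuous (hc.pderiv a) hS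
  have h2 := (tendsto_integral_smul hφ.continuous hc hT).neg
  refine tendsto_nhds_unique h1 (h2.congr fun n => ?_)
  rw [integral_smul_congr (hSf n), integral_smul_congr (hTg n)]
  exact (hfg n φ hφ hc).symm

theorem IsWeakPartialDeriv.ae_eq_zero {a : Fin k}
    {f g : EuclideanSpace ℝ (Fin k) → EuclideanSpace ℝ (Fin d)} (h : IsWeakPartialDeriv a f g)
    (hf : f =ᵐ[volume] 0) (hg : MemLp g 2) : g =ᵐ[volume] 0 := by
  refine ae_eq_zero_of_integral_contDiff_smul_eq_zero
    (hg.locallyIntegrable (by norm_num)) fun φ hφ hc => ?_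
  have := h φ hφ hc
  rw [integral_smul_congr hf] at this
  simpa [eq_comm] using this

/-- Multiplication by `M` need not be bounded on L², so the limit is identified pointwise: along a
common subsequence both sides converge almost everywhere, and each `M x` is continuous. -/
theorem mulField_ae_eq_of_tendsto {S T : ℕ → L2Field k d} {s t : L2Field k d}
    (hS : Tendsto S atTop (𝓝 s)) (hT : Tendsto T atTop (𝓝 t))
    (h : ∀ n, T n =ᵐ[volume] mulField M (S n)) : t =ᵐ[volume] mulField M s := by
  obtain ⟨ns, hns, hns'⟩ := (tendstoInMeasure_of_tendsto_Lp hS).exists_seq_tendsto_ae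
  obtain ⟨ms, hms, hms'⟩ := (tendstoInMeasure_of_tendsto_Lp
    (hT.comp hns.tendsto_atTop)).exists_seq_tendsto_ae
  have hall : ∀ᵐ x, ∀ n, T n x = mulField M (S n) x := ae_all_iff.2 h
  filter_upwards [hns', hms', hall] with x h1 h2 h3
  refine tendsto_nhds_unique h2 ?_
  have h4 := ((opField M x).continuous.tendsto (s x)).comp (h1.comp hms.tendsto_atTop)
  refine h4.congr fun i => ?_
  exact (h3 _).symm

/-- Elements of the closure of the graph have weak derivatives in `L²`, and `Mu ∈ L²`. -/
theorem exists_of_mem_closure_graph (hM : ∀ i j, ContDiff ℝ 2 (fun x => M x i j)) {K : ℝ}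
    (hK : 0 ≤ K)
    (hbd : ∀ u : EuclideanSpace ℝ (Fin k) → EuclideanSpace ℝ (Fin d),
      ContDiff ℝ ∞ u → HasCompactSupport u →
      (∀ a, ∫ x, ‖pderiv a u x‖ ^ 2
        ≤ K * ((∫ x, ‖u x‖ ^ 2) + ∫ x, ‖-(Δ u) x + mulField M u x‖ ^ 2)) ∧
      (∀ a b, ∫ x, ‖pderiv a (pderiv b u) x‖ ^ 2
        ≤ K * ((∫ x, ‖u x‖ ^ 2) + ∫ x, ‖-(Δ u) x + mulField M u x‖ ^ 2)) ∧
      ∫ x, ‖mulField M u x‖ ^ 2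
        ≤ K * ((∫ x, ‖u x‖ ^ 2) + ∫ x, ‖-(Δ u) x + mulField M u x‖ ^ 2))
    {q : L2Field k d × L2Field k d} (hq : q ∈ (schrodingerGraph M).topologicalClosure) :
    ∃ (v : Fin k → L2Field k d) (w : Fin k → Fin k → L2Field k d) (t : L2Field k d),
      (∀ a, IsWeakPartialDeriv a q.1 (v a)) ∧ (∀ a b, IsWeakPartialDeriv b (v a) (w a b)) ∧
      t =ᵐ[volume] mulField M q.1 ∧ q.2 = -∑ a, w a a + t := by
  obtain ⟨p, hpG, hp⟩ := mem_closure_iff_seq_limit.1 hq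
  choose φ hφ hc h1 h2 using hpG
  have hp1 : Tendsto (fun n => (p n).1) atTop (𝓝 q.1) := (continuous_fst.tendsto q).comp hp
  have hp2 : Tendsto (fun n => (p n).2) atTop (𝓝 q.2) := (continuous_snd.tendsto q).comp hp
  have hsub : ∀ a (φ ψ : EuclideanSpace ℝ (Fin k) → EuclideanSpace ℝ (Fin d)), ContDiff ℝ ∞ φ →
      ContDiff ℝ ∞ ψ → pderiv a (φ - ψ) = pderiv a φ - pderiv a ψ := by
    intro a φ ψ hφ hψ
    ext1 x
    rw [pderiv, fderiv_sub (hφ.differentiable (by simp) x) (hψ.differentiable (by simp) x)]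
    rfl
  have mv : ∀ a n, MemLp (pderiv a (φ n)) 2 := fun a n =>
    memLp_of_hasCompactSupport (contDiff_pderiv (hφ n) a).continuous ((hc n).pderiv a)
  have mw : ∀ a b n, MemLp (pderiv b (pderiv a (φ n))) 2 := fun a b n =>
    memLp_of_hasCompactSupport (contDiff_pderiv (contDiff_pderiv (hφ n) a) b).continuous
      (((hc n).pderiv a).pderiv b)
  have mt : ∀ n, MemLp (mulField M (φ n)) 2 := fun n =>
    memLp_of_hasCompactSupport (continuous_mulField hM (hφ n).continuous)
      (hasCompactSupport_mulField (hc n))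
  have hv := fun a => exists_tendsto_of_bound (M := M) (pderiv a) (hsub a) hK
    (fun u hu hc => (hbd u hu hc).1 a) hφ hc hp h1 h2 (mv a)
  have hw := fun a b => exists_tendsto_of_bound (M := M) (fun u => pderiv b (pderiv a u))
    (fun φ ψ hφ hψ => by
      rw [hsub a φ ψ hφ hψ, hsub b _ _ (contDiff_pderiv hφ a) (contDiff_pderiv hψ a)]) hK
    (fun u hu hc => (hbd u hu hc).2.1 b a) hφ hc hp h1 h2 (mw a b)
  obtain ⟨t, ht⟩ := exists_tendsto_of_bound (M := M) (mulField M)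
    (fun φ ψ _ _ => by ext1 x; simp [mulField_apply]) hK
    (fun u hu hc => (hbd u hu hc).2.2) hφ hc hp h1 h2 mt
  choose v hv using hv
  choose w hw using hw
  refine ⟨v, w, t, fun a => ?_, fun a b => ?_, ?_, ?_⟩
  · exact isWeakPartialDeriv_of_tendsto (fun n => isWeakPartialDeriv_pderiv (hφ n) a) hp1 (hv a) h1
      fun n => MemLp.coeFn_toLp _
  · exact isWeakPartialDeriv_of_tendsto
      (fun n => isWeakPartialDeriv_pderiv (contDiff_pderiv (hφ n) a) b) (hv a) (hw a b)
      (fun n => MemLp.coeFn_toLp _) fun n => MemLp.coeFn_toLp _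
  · refine mulField_ae_eq_of_tendsto hp1 ht fun n => ?_
    filter_upwards [(mt n).coeFn_toLp, h1 n] with x hx hx1
    rw [hx, mulField_apply, mulField_apply, hx1]
  -- Uniqueness of limits expresses the second component through the weak derivatives and `Mu` of
  -- the first, which is what makes the operator closable.
  · refine tendsto_nhds_unique hp2
      (((tendsto_finsetSum _ fun a _ => hw a a).neg.add ht).congr fun n => ?_)
    refine Lp.ext ?_
    have hs : ((∑ a, (mw a a n).toLp : L2Field k d) : _ → _)
        =ᵐ[volume] fun x => ∑ a, (mw a a n).toLp _ x := by
      filter_upwards [Lp.coeFn_finsetSum Finset.univ fun a => (mw a a n).toLp] with x hx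
      rw [hx]; simp
    filter_upwards [h2 n, Lp.coeFn_add (-∑ a, (mw a a n).toLp) (mt n).toLp,
      Lp.coeFn_neg (∑ a, (mw a a n).toLp), hs, (mt n).coeFn_toLp,
      ae_all_iff.2 fun a => (mw a a n).coeFn_toLp] with x e1 e2 e3 e4 e5 e6
    rw [e2, Pi.add_apply, e3, Pi.neg_apply, e4, e1, e5,
      laplacian_eq_sum_pderiv ((hφ n).contDiffAt.of_le (by norm_cast))]
    simp_rw [e6]

end Closure

/-! ### Mollification in `L²` -/

section Mollification

open Filter Topology ContinuousLinearMap
open scoped Convolution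

variable {k d : ℕ}

theorem eLpNorm_two_sq {X G : Type*} [MeasurableSpace X] {μ : Measure X} [NormedAddCommGroup G]
    (f : X → G) : eLpNorm f 2 μ ^ 2 = ∫⁻ x, ‖f x‖ₑ ^ 2 ∂μ := by
  have := eLpNorm_nnreal_pow_eq_lintegral (f := f) (μ := μ) (p := 2) (by norm_num)
  simpa using this

/-- Continuity of translation in L², taken from the continuous action of the translation group on
`Lp`. -/
theorem eventually_eLpNorm_translate_sub_le (g : L2Field k d) {η : ℝ≥0∞} (hη : 0 < η) :
    ∀ᶠ t in 𝓝 (0 : EuclideanSpace ℝ (Fin k)), eLpNorm (fun x => g (x - t) - g x) 2 ≤ η := by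
  have : Fact ((2 : ℝ≥0∞) ≠ ⊤) := ⟨by simp⟩
  have hcont : Continuous fun t : EuclideanSpace ℝ (Fin k) => DomAddAct.mk (-t) +ᵥ g := by
    have : Continuous fun t : EuclideanSpace ℝ (Fin k) => DomAddAct.mk (-t) :=
      DomAddAct.continuous_mk.comp continuous_neg
    exact this.vadd continuous_const
  have h0 : DomAddAct.mk (-(0 : EuclideanSpace ℝ (Fin k))) +ᵥ g = g := by simp
  have htend := hcont.tendsto 0
  rw [h0, EMetric.tendsto_nhds] at htend
  filter_upwards [htend η hη] with t ht
  refine le_of_eq_of_le ?_ ht.le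
  rw [Lp.edist_def]
  refine eLpNorm_congr_ae ?_
  filter_upwards [DomAddAct.vadd_Lp_ae_eq (DomAddAct.mk (-t)) g] with x hx
  rw [Pi.sub_apply, hx]
  simp [sub_eq_neg_add]

/-- The mollifier is a probability density, so the difference is an average of `g (x - t) - g x`,
and the L¹ norm for a probability measure is at most the L² norm. -/
theorem enorm_convolution_sub_sq_le (φ : ContDiffBump (0 : EuclideanSpace ℝ (Fin k)))
    (g : L2Field k d) (x : EuclideanSpace ℝ (Fin k)) :
    ‖(φ.normed volume ⋆[lsmul ℝ ℝ, volume] g) x - g x‖ₑ ^ 2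
      ≤ ∫⁻ t, ‖g (x - t) - g x‖ₑ ^ 2
        ∂(volume.withDensity fun t => ENNReal.ofReal (φ.normed volume t)) := by
  set ν := (volume : Measure (EuclideanSpace ℝ (Fin k))).withDensity
    fun t => ENNReal.ofReal (φ.normed volume t) with hν
  have hmeas : Measurable fun t => ENNReal.ofReal (φ.normed volume t) :=
    (φ.continuous_normed.measurable).ennreal_ofReal
  have hprob : IsProbabilityMeasure ν := by
    constructor
    rw [hν, withDensity_apply _ MeasurableSet.univ, Measure.restrict_univ,
      ← ofReal_integral_eq_lintegral_ofReal φ.integrable_normed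
        (Eventually.of_forall φ.nonneg_normed), φ.integral_normed, ENNReal.ofReal_one]
  have hgm : StronglyMeasurable g := Lp.stronglyMeasurable g
  have hli : LocallyIntegrable g volume := (Lp.memLp g).locallyIntegrable (by norm_num)
  have h1 : Integrable fun t => φ.normed volume t • g (x - t) :=
    φ.hasCompactSupport_normed.convolutionExists_left (lsmul ℝ ℝ) φ.continuous_normed hli x
  have h2 : Integrable fun t => φ.normed volume t • g x := φ.integrable_normed.smul_const _
  have e1 : (φ.normed volume ⋆[lsmul ℝ ℝ, volume] g) x - g x
      = ∫ t, φ.normed volume t • (g (x - t) - g x) := by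
    simp_rw [smul_sub]
    rw [integral_sub h1 h2, integral_smul_const, φ.integral_normed, one_smul]
    rfl
  have hdm : StronglyMeasurable fun t => g (x - t) - g x :=
    (hgm.comp_measurable (measurable_const.sub measurable_id)).sub stronglyMeasurable_const
  have e2 : ‖(φ.normed volume ⋆[lsmul ℝ ℝ, volume] g) x - g x‖ₑ
      ≤ eLpNorm (fun t => g (x - t) - g x) 1 ν := by
    rw [e1, eLpNorm_one_eq_lintegral_enorm, hν,
      lintegral_withDensity_eq_lintegral_mul _ hmeas hdm.enorm]
    refine (enorm_integral_le_lintegral_enorm _).trans (le_of_eq ?_)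
    refine lintegral_congr fun t => ?_
    rw [enorm_smul, Real.enorm_eq_ofReal (φ.nonneg_normed t)]
    rfl
  calc _ ≤ eLpNorm (fun t => g (x - t) - g x) 2 ν ^ 2 := by
        gcongr
        exact e2.trans (eLpNorm_le_eLpNorm_of_exponent_le (by norm_num) hdm.aestronglyMeasurable)
    _ = _ := eLpNorm_two_sq _

/-- Mollifications of an `L²` function converge in `L²`. -/
theorem tendsto_eLpNorm_convolution_sub {φ : ℕ → ContDiffBump (0 : EuclideanSpace ℝ (Fin k))}
    (hφ : Tendsto (fun n => (φ n).rOut) atTop (𝓝 0)) (g : L2Field k d) :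
    Tendsto (fun n => eLpNorm
      (fun x => ((φ n).normed volume ⋆[lsmul ℝ ℝ, volume] g) x - g x) 2 volume)
      atTop (𝓝 0) := by
  rw [ENNReal.tendsto_nhds_zero]
  intro η hη
  obtain ⟨δ, hδ, hball⟩ := Metric.eventually_nhds_iff_ball.1
    (eventually_eLpNorm_translate_sub_le g hη)
  filter_upwards [hφ.eventually (gt_mem_nhds hδ)] with n hn
  refine le_of_not_gt fun hlt => ?_
  have hsq : η ^ 2 < eLpNorm
      (fun x => ((φ n).normed volume ⋆[lsmul ℝ ℝ, volume] g) x - g x) 2 volume ^ 2 :=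
    ENNReal.pow_lt_pow_left (by norm_num) hlt
  refine absurd hsq (not_lt.2 ?_)
  rw [eLpNorm_two_sq]
  set ν := (volume : Measure (EuclideanSpace ℝ (Fin k))).withDensity
    fun t => ENNReal.ofReal ((φ n).normed volume t) with hν
  have hmeas : Measurable fun t => ENNReal.ofReal ((φ n).normed volume t) :=
    ((φ n).continuous_normed.measurable).ennreal_ofReal
  have hprob : ν Set.univ = 1 := by
    rw [hν, withDensity_apply _ MeasurableSet.univ, Measure.restrict_univ,
      ← ofReal_integral_eq_lintegral_ofReal (φ n).integrable_normed
        (Eventually.of_forall (φ n).nonneg_normed), (φ n).integral_normed, ENNReal.ofReal_one]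
  have hfin : IsFiniteMeasure ν := ⟨by rw [hprob]; exact ENNReal.one_lt_top⟩
  have hgm : StronglyMeasurable g := Lp.stronglyMeasurable g
  have hjm : Measurable fun z : EuclideanSpace ℝ (Fin k) × EuclideanSpace ℝ (Fin k) =>
      ‖g (z.1 - z.2) - g z.1‖ₑ ^ 2 :=
    (((hgm.comp_measurable (measurable_fst.sub measurable_snd)).sub
      (hgm.comp_measurable measurable_fst)).enorm).pow_const 2
  -- After Tonelli the inner integral is the squared L² size of a translation difference; the
  -- density charges only those `t` for which it is at most `η²`.
  calc _ ≤ ∫⁻ x, ∫⁻ t, ‖g (x - t) - g x‖ₑ ^ 2 ∂ν :=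
        lintegral_mono fun x => enorm_convolution_sub_sq_le (φ n) g x
    _ = ∫⁻ t, (∫⁻ x, ‖g (x - t) - g x‖ₑ ^ 2) ∂ν :=
        lintegral_lintegral_swap hjm.aemeasurable
    _ ≤ ∫⁻ t, η ^ 2 ∂ν := by
        refine lintegral_mono_ae ?_
        rw [hν, ae_withDensity_iff hmeas]
        refine Eventually.of_forall fun t ht => ?_
        have htb : t ∈ Metric.ball (0 : EuclideanSpace ℝ (Fin k)) (φ n).rOut := by
          rw [← (φ n).support_normed_eq (μ := volume)]
          intro h0
          rw [h0, ENNReal.ofReal_zero] at ht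
          exact ht rfl
        rw [← eLpNorm_two_sq]
        gcongr
        exact hball t (Metric.ball_subset_ball hn.le htb)
    _ = η ^ 2 := by rw [lintegral_const, hprob, mul_one]

end Mollification

/-! ### Density of the test functions -/

section Density

open Filter Topology ContinuousLinearMap
open scoped Convolution

variable {k d : ℕ} {M : EuclideanSpace ℝ (Fin k) → Matrix (Fin d) (Fin d) ℝ}

/-- `g` is the weak Laplacian of `u`. -/
def HasWeakLaplacian (u g : EuclideanSpace ℝ (Fin k) → EuclideanSpace ℝ (Fin d)) : Prop :=
  ∀ φ : EuclideanSpace ℝ (Fin k) → ℝ, ContDiff ℝ ∞ φ → HasCompactSupport φ →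
    ∫ x, (∑ a, pderiv a (pderiv a φ) x) • u x = ∫ x, φ x • g x

theorem integrable_smul_of_memLp {φ : EuclideanSpace ℝ (Fin k) → ℝ}
    {u : EuclideanSpace ℝ (Fin k) → EuclideanSpace ℝ (Fin d)} (hφ : Continuous φ)
    (hc : HasCompactSupport φ) (hu : MemLp u 2) : Integrable fun x => φ x • u x :=
  (hu.locallyIntegrable (by norm_num)).integrable_smul_left_of_hasCompactSupport hφ hc

theorem hasWeakLaplacian_sum
    {u : EuclideanSpace ℝ (Fin k) → EuclideanSpace ℝ (Fin d)}
    {v w : Fin k → EuclideanSpace ℝ (Fin k) → EuclideanSpace ℝ (Fin d)} (hu : MemLp u 2)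
    (hw : ∀ a, MemLp (w a) 2) (huv : ∀ a, IsWeakPartialDeriv a u (v a))
    (hvw : ∀ a, IsWeakPartialDeriv a (v a) (w a)) :
    HasWeakLaplacian u (fun x => ∑ a, w a x) := by
  intro φ hφ hc
  simp_rw [Finset.sum_smul, Finset.smul_sum]
  rw [integral_finsetSum _ fun a _ => integrable_smul_of_memLp
      (contDiff_pderiv (contDiff_pderiv hφ a) a).continuous ((hc.pderiv a).pderiv a) hu,
    integral_finsetSum _ fun a _ => integrable_smul_of_memLp hφ.continuous hc (hw a)]
  refine Finset.sum_congr rfl fun a _ => ?_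
  have h1 := huv a (pderiv a φ) (contDiff_pderiv hφ a) (hc.pderiv a)
  have h2 := hvw a φ hφ hc
  change ∫ x, pderiv a (pderiv a φ) x • u x = _ at h1
  change ∫ x, pderiv a φ x • v a x = _ at h2
  rw [h1, h2, neg_neg]

theorem pderiv_convolution {ρ : EuclideanSpace ℝ (Fin k) → ℝ}
    {u : EuclideanSpace ℝ (Fin k) → EuclideanSpace ℝ (Fin d)} (hρ : ContDiff ℝ ∞ ρ)
    (hc : HasCompactSupport ρ) (hu : LocallyIntegrable u) (a : Fin k) :
    pderiv a (ρ ⋆[lsmul ℝ ℝ, volume] u) = pderiv a ρ ⋆[lsmul ℝ ℝ, volume] u := by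
  ext1 x
  have hρ1 : ContDiff ℝ 1 ρ := hρ.of_le (by norm_cast)
  have hint : Integrable fun t => (lsmul ℝ ℝ : ℝ →L[ℝ] EuclideanSpace ℝ (Fin d) →L[ℝ]
      EuclideanSpace ℝ (Fin d)).precompL (EuclideanSpace ℝ (Fin k)) (fderiv ℝ ρ t) (u (x - t)) :=
    (hc.fderiv ℝ).convolutionExists_left _ (hρ1.continuous_fderiv (by norm_num)) hu x
  rw [pderiv, (hc.hasFDerivAt_convolution_left (lsmul ℝ ℝ) hρ1 hu x).fderiv, convolution_def,
    ContinuousLinearMap.integral_apply hint, convolution_def]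
  exact integral_congr_ae (Eventually.of_forall fun t => rfl)

theorem pderiv_comp_const_sub {ρ : EuclideanSpace ℝ (Fin k) → ℝ} (hρ : Differentiable ℝ ρ)
    (a : Fin k) (x : EuclideanSpace ℝ (Fin k)) :
    pderiv a (fun t => ρ (x - t)) = fun t => -pderiv a ρ (x - t) := by
  ext1 t
  have h := ((hρ (x - t)).hasFDerivAt.comp t ((hasFDerivAt_id t).const_sub x)).fderiv
  change fderiv ℝ (ρ ∘ fun t => x - t) t _ = _
  rw [h]
  simp [pderiv]

/-- Derivatives of the convolution fall on `ρ`. The weak identity, tested against `t ↦ ρ (x - t)`,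
transfers the Laplacian to `u`; the two signs from the reflection cancel. -/
theorem sum_pderiv_convolution {ρ : EuclideanSpace ℝ (Fin k) → ℝ}
    {u g : EuclideanSpace ℝ (Fin k) → EuclideanSpace ℝ (Fin d)} (hρ : ContDiff ℝ ∞ ρ)
    (hc : HasCompactSupport ρ) (hu : MemLp u 2) (hg : HasWeakLaplacian u g)
    (x : EuclideanSpace ℝ (Fin k)) :
    ∑ a, pderiv a (pderiv a (ρ ⋆[lsmul ℝ ℝ, volume] u)) x = (ρ ⋆[lsmul ℝ ℝ, volume] g) x := by
  have hli : LocallyIntegrable u := hu.locallyIntegrable (by norm_num)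
  have hφ : ContDiff ℝ ∞ fun t => ρ (x - t) := hρ.comp (contDiff_const.sub contDiff_id)
  have hφc : HasCompactSupport fun t => ρ (x - t) :=
    hc.comp_homeomorph (Homeomorph.subLeft x)
  have hφ2 : ∀ a t, pderiv a (pderiv a fun t => ρ (x - t)) t = pderiv a (pderiv a ρ) (x - t) := by
    intro a t
    rw [pderiv_comp_const_sub (hρ.differentiable (by simp))]
    have h2 := congrFun (pderiv_comp_const_sub
      ((contDiff_pderiv hρ a).differentiable (by simp)) a x) t
    have h3 : pderiv a (fun t => -pderiv a ρ (x - t)) t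
        = -pderiv a (fun t => pderiv a ρ (x - t)) t := by
      rw [pderiv, fderiv_fun_neg]; rfl
    rw [h3, h2, neg_neg]
  have h := hg _ hφ hφc
  simp_rw [hφ2, Finset.sum_smul] at h
  rw [integral_finsetSum] at h
  · rw [convolution_eq_swap]
    refine Eq.trans (Finset.sum_congr rfl fun a _ => ?_) h
    rw [pderiv_convolution hρ hc hli, pderiv_convolution (contDiff_pderiv hρ a) (hc.pderiv a) hli,
      convolution_eq_swap]
    rfl
  · intro a _
    simp_rw [← hφ2]
    exact integrable_smul_of_memLp (contDiff_pderiv (contDiff_pderiv hφ a) a).continuous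
      ((hφc.pderiv a).pderiv a) hu

theorem mem_schrodingerGraph_toLp
    {u : EuclideanSpace ℝ (Fin k) → EuclideanSpace ℝ (Fin d)} (hu : ContDiff ℝ ∞ u)
    (hc : HasCompactSupport u) (h1 : MemLp u 2 volume)
    (h2 : MemLp (fun x => -(Δ u) x + mulField M u x) 2 volume) :
    ((h1.toLp, h2.toLp) : L2Field k d × L2Field k d) ∈ schrodingerGraph M :=
  ⟨u, hu, hc, h1.coeFn_toLp, h2.coeFn_toLp⟩

theorem tendsto_toLp_of_tendsto_eLpNorm {f : ℕ → EuclideanSpace ℝ (Fin k) → EuclideanSpace ℝ (Fin d)}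
    (hf : ∀ n, MemLp (f n) 2) {q : L2Field k d}
    (h : Tendsto (fun n => eLpNorm (fun x => f n x - q x) 2 volume) atTop (𝓝 0)) :
    Tendsto (fun n => (hf n).toLp) atTop (𝓝 q) := by
  rw [tendsto_iff_edist_tendsto_0]
  refine h.congr fun n => ?_
  rw [Lp.edist_def]
  refine eLpNorm_congr_ae ?_
  filter_upwards [(hf n).coeFn_toLp] with x hx
  rw [Pi.sub_apply, hx]

/-- A compactly supported `u` with weak Laplacian in `L²` belongs to the domain of the closure. -/
theorem mem_closure_of_hasCompactSupport (hM : ∀ i j, ContDiff ℝ 2 (fun x => M x i j))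
    {u g : EuclideanSpace ℝ (Fin k) → EuclideanSpace ℝ (Fin d)} (hc : HasCompactSupport u)
    (hu : MemLp u 2) (hg : MemLp g 2) (hw : HasWeakLaplacian u g) {q : L2Field k d × L2Field k d}
    (h1 : q.1 =ᵐ[volume] u) (h2 : q.2 =ᵐ[volume] fun x => -g x + mulField M u x) :
    q ∈ (schrodingerGraph M).topologicalClosure := by
  let φ : ℕ → ContDiffBump (0 : EuclideanSpace ℝ (Fin k)) := fun n =>
    ⟨1 / ((n : ℝ) + 1) / 2, 1 / ((n : ℝ) + 1), by positivity, half_lt_self (by positivity)⟩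
  have hφ : Tendsto (fun n => (φ n).rOut) atTop (𝓝 0) := tendsto_one_div_add_atTop_nhds_zero_nat
  have hφ1 : ∀ n, (φ n).rOut ≤ 1 := fun n => by
    change 1 / ((n : ℝ) + 1) ≤ 1
    rw [div_le_one (by positivity)]
    linarith [(Nat.cast_nonneg n : (0 : ℝ) ≤ n)]
  set ρ := fun n => (φ n).normed volume with hρdef
  have hρ : ∀ n, ContDiff ℝ ∞ (ρ n) := fun n => (φ n).contDiff_normed
  have hρc : ∀ n, HasCompactSupport (ρ n) := fun n => (φ n).hasCompactSupport_normed
  have hli : LocallyIntegrable u := hu.locallyIntegrable (by norm_num)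
  set ψ := fun n => (ρ n ⋆[lsmul ℝ ℝ, volume] u) with hψdef
  have hψ : ∀ n, ContDiff ℝ ∞ (ψ n) := fun n => (hρc n).contDiff_convolution_left _ (hρ n) hli
  have hψc : ∀ n, HasCompactSupport (ψ n) := fun n => (hρc n).convolution _ hc
  have hψL : ∀ n, MemLp (ψ n) 2 := fun n => memLp_of_hasCompactSupport (hψ n).continuous (hψc n)
  have hPL : ∀ n, MemLp (fun x => -(Δ (ψ n)) x + mulField M (ψ n) x) 2 := fun n =>
    memLp_of_hasCompactSupport (continuous_schrodinger hM (hψ n))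
      (hasCompactSupport_neg_laplacian_add (hψ n) (hψc n))
  have t1 : Tendsto (fun n => eLpNorm (fun x => ψ n x - u x) 2 volume) atTop (𝓝 0) := by
    refine (tendsto_eLpNorm_convolution_sub hφ hu.toLp).congr fun n => eLpNorm_congr_ae ?_
    filter_upwards [hu.coeFn_toLp] with x hx
    rw [hx, convolution_congr _ (ae_eq_refl _) hu.coeFn_toLp]
  have t2 : Tendsto (fun n => eLpNorm (fun x => (ρ n ⋆[lsmul ℝ ℝ, volume] g) x - g x) 2 volume)
      atTop (𝓝 0) := by
    refine (tendsto_eLpNorm_convolution_sub hφ hg.toLp).congr fun n => eLpNorm_congr_ae ?_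
    filter_upwards [hg.coeFn_toLp] with x hx
    rw [hx, convolution_congr _ (ae_eq_refl _) hg.coeFn_toLp]
  -- All mollifications are supported in the closed 1-thickening of the support of `u`, since the
  -- radii are at most 1. On this compact set `M` is bounded, so `M ψ n` converges along with `ψ n`.
  obtain ⟨B, hB⟩ := (hc.isCompact.cthickening (r := 1)).exists_bound_of_continuousOn
    (contDiff_opField hM).continuous.continuousOn
  have hsupp : ∀ n x, x ∉ Metric.cthickening 1 (tsupport u) → ψ n x = 0 ∧ u x = 0 := by
    intro n x hx
    have hxu : x ∉ tsupport u := fun h => hx (Metric.self_subset_cthickening _ h)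
    refine ⟨by_contra fun h0 => hx ?_, image_eq_zero_of_notMem_tsupport hxu⟩
    obtain ⟨y, hy, z, hz, rfl⟩ := support_convolution_subset (lsmul ℝ ℝ) h0
    rw [(φ n).support_normed_eq, Metric.mem_ball, dist_zero_right] at hy
    refine Metric.mem_cthickening_of_dist_le _ z _ _ (subset_tsupport _ hz) ?_
    rw [dist_eq_norm]
    simpa using hy.le.trans (hφ1 n)
  have hMbd : ∀ n x, ‖mulField M (ψ n) x - mulField M u x‖ ≤ |B| * ‖ψ n x - u x‖ := by
    intro n x
    rw [mulField_apply, mulField_apply, ← map_sub]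
    by_cases hx : x ∈ Metric.cthickening 1 (tsupport u)
    · exact (ContinuousLinearMap.le_opNorm _ _).trans
        (by gcongr; exact (hB x hx).trans (le_abs_self B))
    · simp [hsupp n x hx]
  have hlap : ∀ n x, (Δ (ψ n)) x = (ρ n ⋆[lsmul ℝ ℝ, volume] g) x := by
    intro n x
    rw [laplacian_eq_sum_pderiv ((hψ n).contDiffAt.of_le (by norm_cast)),
      sum_pderiv_convolution (hρ n) (hρc n) hu hw]
  have t3 : Tendsto (fun n => eLpNorm (fun x => mulField M (ψ n) x - mulField M u x) 2 volume)
      atTop (𝓝 0) := by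
    have hle : ∀ n, eLpNorm (fun x => mulField M (ψ n) x - mulField M u x) 2 volume
        ≤ ENNReal.ofReal |B| * eLpNorm (fun x => ψ n x - u x) 2 volume := fun n =>
      eLpNorm_le_mul_eLpNorm_of_ae_le_mul (Eventually.of_forall (hMbd n)) 2
    refine tendsto_of_tendsto_of_tendsto_of_le_of_le tendsto_const_nhds ?_ (fun _ => zero_le) hle
    simpa using ENNReal.Tendsto.const_mul t1 (Or.inr ENNReal.ofReal_ne_top)
  refine mem_closure_iff_seq_limit.2 ⟨fun n => ((hψL n).toLp, (hPL n).toLp),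
    fun n => mem_schrodingerGraph_toLp (hψ n) (hψc n) (hψL n) (hPL n), ?_⟩
  refine Tendsto.prodMk_nhds (y := q.2) (x := q.1) (tendsto_toLp_of_tendsto_eLpNorm hψL ?_)
    (tendsto_toLp_of_tendsto_eLpNorm hPL ?_)
  · refine t1.congr fun n => eLpNorm_congr_ae ?_
    filter_upwards [h1] with x hx
    rw [hx]
  · have hgm : ∀ n, AEStronglyMeasurable
        (fun x => (ρ n ⋆[lsmul ℝ ℝ, volume] g) x - g x) volume := fun n =>
      (((hρc n).contDiff_convolution_left _ (hρ n)
        (hg.locallyIntegrable (by norm_num))).continuous.aestronglyMeasurable).sub hg.1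
    have hMm : AEStronglyMeasurable (mulField M u) volume :=
      Continuous.comp_aestronglyMeasurable₂ (g := fun (A : EuclideanSpace ℝ (Fin d) →L[ℝ]
        EuclideanSpace ℝ (Fin d)) v => A v) (by fun_prop)
        (contDiff_opField hM).continuous.aestronglyMeasurable hu.1
    have hle : ∀ n, eLpNorm (fun x => -(Δ (ψ n)) x + mulField M (ψ n) x - q.2 x) 2 volume
        ≤ eLpNorm (fun x => mulField M (ψ n) x - mulField M u x) 2 volume
          + eLpNorm (fun x => (ρ n ⋆[lsmul ℝ ℝ, volume] g) x - g x) 2 volume := by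
      intro n
      refine le_trans (le_of_eq ?_) (eLpNorm_sub_le
        ((continuous_mulField hM (hψ n).continuous).aestronglyMeasurable.sub hMm) (hgm n)
        (by norm_num))
      refine eLpNorm_congr_ae ?_
      filter_upwards [h2] with x hx
      rw [hx, hlap]
      simp only [Pi.sub_apply]
      abel
    refine tendsto_of_tendsto_of_tendsto_of_le_of_le tendsto_const_nhds ?_ (fun _ => zero_le) hle
    simpa using t3.add t2

end Density

/-! ### Truncation of functions in the domain -/

section Cutoff

open Filter Topology

variable {k d : ℕ} {M : EuclideanSpace ℝ (Fin k) → Matrix (Fin d) (Fin d) ℝ}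

theorem pderiv_mul {a : Fin k} {f g : EuclideanSpace ℝ (Fin k) → ℝ}
    {x : EuclideanSpace ℝ (Fin k)} (hf : DifferentiableAt ℝ f x) (hg : DifferentiableAt ℝ g x) :
    pderiv a (fun y => f y * g y) x = pderiv a f x * g x + f x * pderiv a g x := by
  simpa only [smul_eq_mul] using pderiv_smul (a := a) hf hg

/-- The product rule for the weak Laplacian. -/
theorem HasWeakLaplacian.smul
    {u g : EuclideanSpace ℝ (Fin k) → EuclideanSpace ℝ (Fin d)}
    {v : Fin k → EuclideanSpace ℝ (Fin k) → EuclideanSpace ℝ (Fin d)} (hu : MemLp u 2)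
    (hv : ∀ a, MemLp (v a) 2) (hg : MemLp g 2) (h : HasWeakLaplacian u g)
    (huv : ∀ a, IsWeakPartialDeriv a u (v a)) {χ : EuclideanSpace ℝ (Fin k) → ℝ}
    (hχ : ContDiff ℝ ∞ χ) :
    HasWeakLaplacian (fun x => χ x • u x) (fun x => χ x • g x
      + ∑ a, ((2 * pderiv a χ x) • v a x + pderiv a (pderiv a χ) x • u x)) := by
  intro φ hφ hc
  have hφ1 : ∀ a, ContDiff ℝ ∞ (pderiv a φ) := contDiff_pderiv hφ
  have hφ2 : ∀ a, ContDiff ℝ ∞ (pderiv a (pderiv a φ)) := fun a => contDiff_pderiv (hφ1 a) a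
  have hχ1 : ∀ a, ContDiff ℝ ∞ (pderiv a χ) := contDiff_pderiv hχ
  have hχ2 : ∀ a, ContDiff ℝ ∞ (pderiv a (pderiv a χ)) := fun a => contDiff_pderiv (hχ1 a) a
  have hd : ∀ {f : EuclideanSpace ℝ (Fin k) → ℝ}, ContDiff ℝ ∞ f → Differentiable ℝ f :=
    fun hf => hf.differentiable (by simp)
  have hprod : ContDiff ℝ ∞ fun x => φ x * χ x := hφ.mul hχ
  have hprodc : HasCompactSupport fun x => φ x * χ x := hc.mul_right
  have hψ : ∀ a, ContDiff ℝ ∞ fun x => φ x * pderiv a χ x := fun a => hφ.mul (hχ1 a)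
  have hψc : ∀ a, HasCompactSupport fun x => φ x * pderiv a χ x := fun a => hc.mul_right
  -- The product rule is arranged so that the mixed term is a full derivative of the test function
  -- `φ ∂_a χ`, to which the definition of the weak derivative applies.
  have e1 : ∀ a x, pderiv a (pderiv a fun x => φ x * χ x) x = pderiv a (pderiv a φ) x * χ x
      + 2 * pderiv a (fun x => φ x * pderiv a χ x) x - φ x * pderiv a (pderiv a χ) x := by
    intro a x
    have : pderiv a (fun x => φ x * χ x) = fun x => pderiv a φ x * χ x + φ x * pderiv a χ x := by
      ext1 y; exact pderiv_mul (hd hφ y) (hd hχ y)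
    rw [this, pderiv_add ((hd (hφ1 a) x).fun_mul (hd hχ x)) ((hd hφ x).fun_mul (hd (hχ1 a) x)),
      pderiv_mul (hd (hφ1 a) x) (hd hχ x), pderiv_mul (hd hφ x) (hd (hχ1 a) x)]
    ring
  have h1 := h _ hprod hprodc
  have h2 := fun a => huv a _ (hψ a) (hψc a)
  change ∀ a, ∫ x, pderiv a (fun x => φ x * pderiv a χ x) x • u x = _ at h2
  have iA : ∀ a, Integrable fun x => (pderiv a (pderiv a φ) x * χ x) • u x := fun a =>
    integrable_smul_of_memLp ((hφ2 a).continuous.mul hχ.continuous)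
      ((hc.pderiv a).pderiv a).mul_right hu
  have iB : ∀ a, Integrable fun x => pderiv a (fun x => φ x * pderiv a χ x) x • u x := fun a =>
    integrable_smul_of_memLp (contDiff_pderiv (hψ a) a).continuous ((hψc a).pderiv a) hu
  have iC : ∀ a, Integrable fun x => (φ x * pderiv a (pderiv a χ) x) • u x := fun a =>
    integrable_smul_of_memLp (hφ.continuous.mul (hχ2 a).continuous) hc.mul_right hu
  have iD : ∀ a, Integrable fun x => (φ x * pderiv a χ x) • v a x := fun a =>
    integrable_smul_of_memLp (hφ.continuous.mul (hχ1 a).continuous) hc.mul_right (hv a)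
  have iE : Integrable fun x => (φ x * χ x) • g x :=
    integrable_smul_of_memLp hprod.continuous hprodc hg
  have L1 : ∫ x, (∑ a, pderiv a (pderiv a fun x => φ x * χ x) x) • u x
      = ∑ a, ((∫ x, (pderiv a (pderiv a φ) x * χ x) • u x)
        + (2 : ℝ) • (∫ x, pderiv a (fun x => φ x * pderiv a χ x) x • u x)
        - ∫ x, (φ x * pderiv a (pderiv a χ) x) • u x) := by
    have : ∀ x, (∑ a, pderiv a (pderiv a fun x => φ x * χ x) x) • u x
        = ∑ a, ((pderiv a (pderiv a φ) x * χ x) • u x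
          + (2 : ℝ) • (pderiv a (fun x => φ x * pderiv a χ x) x • u x)
          - (φ x * pderiv a (pderiv a χ) x) • u x) := by
      intro x
      rw [Finset.sum_smul]
      refine Finset.sum_congr rfl fun a _ => ?_
      rw [e1, sub_smul, add_smul, smul_smul]
    simp_rw [this]
    have iG : ∀ a, Integrable fun x => (pderiv a (pderiv a φ) x * χ x) • u x
        + (2 : ℝ) • (pderiv a (fun x => φ x * pderiv a χ x) x • u x)
        - (φ x * pderiv a (pderiv a χ) x) • u x := fun a =>
      ((iA a).add ((iB a).smul (2 : ℝ))).sub (iC a)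
    rw [integral_finsetSum _ fun a _ => iG a]
    refine Finset.sum_congr rfl fun a _ => ?_
    have h := integral_sub ((iA a).add ((iB a).smul (2 : ℝ))) (iC a)
    have h' := integral_add (iA a) ((iB a).smul (2 : ℝ))
    have h'' := integral_smul (μ := volume) (2 : ℝ)
      (fun x => pderiv a (fun x => φ x * pderiv a χ x) x • u x)
    rw [← h'']
    exact h.trans (congrArg (· - _) h')
  have L2 : ∫ x, (∑ a, pderiv a (pderiv a φ) x) • χ x • u x
      = ∑ a, ∫ x, (pderiv a (pderiv a φ) x * χ x) • u x := by
    rw [← integral_finsetSum _ fun a _ => iA a]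
    refine integral_congr_ae (Eventually.of_forall fun x => ?_)
    change _ = ∑ a, (pderiv a (pderiv a φ) x * χ x) • u x
    simp_rw [Finset.sum_smul, smul_smul]
  have L3 : ∫ x, φ x • (χ x • g x
      + ∑ a, ((2 * pderiv a χ x) • v a x + pderiv a (pderiv a χ) x • u x))
      = (∫ x, (φ x * χ x) • g x) + ∑ a, ((2 : ℝ) • (∫ x, (φ x * pderiv a χ x) • v a x)
        + ∫ x, (φ x * pderiv a (pderiv a χ) x) • u x) := by
    have : ∀ x, φ x • (χ x • g x
        + ∑ a, ((2 * pderiv a χ x) • v a x + pderiv a (pderiv a χ) x • u x))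
        = (φ x * χ x) • g x + ∑ a, ((2 : ℝ) • ((φ x * pderiv a χ x) • v a x)
          + (φ x * pderiv a (pderiv a χ) x) • u x) := by
      intro x
      rw [smul_add, smul_smul, Finset.smul_sum]
      congr 1
      refine Finset.sum_congr rfl fun a _ => ?_
      rw [smul_add, smul_smul, smul_smul, smul_smul]
      congr 2
      ring
    simp_rw [this]
    have iF : ∀ a, Integrable fun x => (2 : ℝ) • ((φ x * pderiv a χ x) • v a x)
          + (φ x * pderiv a (pderiv a χ) x) • u x := fun a => ((iD a).smul (2 : ℝ)).add (iC a)
    rw [integral_add iE (integrable_finsetSum _ fun a _ => iF a),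
      integral_finsetSum _ fun a _ => iF a]
    congr 1
    refine Finset.sum_congr rfl fun a _ => ?_
    rw [← integral_smul]
    exact integral_add ((iD a).smul (2 : ℝ)) (iC a)
  rw [L1] at h1
  rw [L2, L3, ← h1, ← Finset.sum_add_distrib]
  refine Finset.sum_congr rfl fun a _ => ?_
  rw [h2 a, smul_neg]
  abel

/-- Multiplication by bounded functions that eventually vanish at each point tends to `0` in `L²`. -/
theorem tendsto_eLpNorm_smul_zero {h : EuclideanSpace ℝ (Fin k) → EuclideanSpace ℝ (Fin d)}
    (hh : MemLp h 2) {c : ℕ → EuclideanSpace ℝ (Fin k) → ℝ} (hc : ∀ n, Continuous (c n)) {B : ℝ}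
    (hB : ∀ n x, |c n x| ≤ B) (h0 : ∀ x, ∀ᶠ n in atTop, c n x = 0) :
    Tendsto (fun n => eLpNorm (fun x => c n x • h x) 2 volume) atTop (𝓝 0) := by
  have hB0 : 0 ≤ B := (abs_nonneg _).trans (hB 0 0)
  have key : Tendsto (fun n => eLpNorm (fun x => c n x • h x) 2 volume ^ 2) atTop (𝓝 0) := by
    simp_rw [eLpNorm_two_sq]
    have hfin : ∫⁻ x, ENNReal.ofReal B ^ 2 * ‖h x‖ₑ ^ 2 ≠ ⊤ := by
      rw [lintegral_const_mul' _ _ (by finiteness), ← eLpNorm_two_sq]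
      exact ENNReal.mul_ne_top (by finiteness) (ENNReal.pow_ne_top hh.2.ne)
    have := tendsto_lintegral_of_dominated_convergence' (μ := volume)
      (F := fun n x => ‖c n x • h x‖ₑ ^ 2) (f := fun _ => 0)
      (fun x => ENNReal.ofReal B ^ 2 * ‖h x‖ₑ ^ 2)
      (fun n => (((hc n).aestronglyMeasurable.smul hh.1).enorm).pow_const 2)
      (fun n => Eventually.of_forall fun x => ?_) hfin (Eventually.of_forall fun x => ?_)
    · simpa using this
    · change ‖c n x • h x‖ₑ ^ 2 ≤ _
      have hcB : ‖c n x‖ₑ ≤ ENNReal.ofReal B := by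
        rw [← ofReal_norm, Real.norm_eq_abs]
        exact ENNReal.ofReal_le_ofReal (hB n x)
      rw [enorm_smul, mul_pow]
      exact mul_le_mul' (pow_le_pow_left' hcB 2) le_rfl
    · refine tendsto_const_nhds.congr' ?_
      filter_upwards [h0 x] with n hn
      simp [hn]
  have h2 := ((ENNReal.continuous_rpow_const (y := 1 / 2)).tendsto 0).comp key
  rw [ENNReal.zero_rpow_of_pos (by norm_num)] at h2
  refine h2.congr fun n => ?_
  simp only [Function.comp_apply]
  rw [← ENNReal.rpow_natCast, ← ENNReal.rpow_mul]
  norm_num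

theorem pderiv_comp_smul {f : EuclideanSpace ℝ (Fin k) → ℝ} (hf : Differentiable ℝ f) (s : ℝ)
    (a : Fin k) : pderiv a (fun x => f (s • x)) = fun x => s * pderiv a f (s • x) := by
  ext1 x
  have h := ((hf (s • x)).hasFDerivAt.comp x ((hasFDerivAt_id x).const_smul s)).fderiv
  change fderiv ℝ (f ∘ HSMul.hSMul s) x _ = _
  rw [h]
  simp [pderiv]

/-- Cutoff functions with uniformly bounded derivatives that exhaust the space. -/
theorem exists_cutoff_sequence (k : ℕ) :
    ∃ (χ : ℕ → EuclideanSpace ℝ (Fin k) → ℝ) (B : ℝ), (∀ n, ContDiff ℝ ∞ (χ n)) ∧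
      (∀ n, HasCompactSupport (χ n)) ∧ (∀ n x, |χ n x - 1| ≤ B) ∧
      (∀ n a x, |pderiv a (χ n) x| ≤ B) ∧ (∀ n a x, |pderiv a (pderiv a (χ n)) x| ≤ B) ∧
      ∀ x, ∀ᶠ n in atTop, χ n =ᶠ[𝓝 x] fun _ => 1 := by
  let f : ContDiffBump (0 : EuclideanSpace ℝ (Fin k)) := ⟨1, 2, by norm_num, by norm_num⟩
  have hf : ContDiff ℝ ∞ f := f.contDiff
  have hfc : HasCompactSupport f := f.hasCompactSupport
  have hb1 := fun a => (contDiff_pderiv hf a).continuous.bounded_above_of_compact_support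
    (hfc.pderiv a)
  have hb2 := fun a => (contDiff_pderiv (contDiff_pderiv hf a) a).continuous.bounded_above_of_compact_support
    ((hfc.pderiv a).pderiv a)
  choose B₁ hB₁ using hb1
  choose B₂ hB₂ using hb2
  have hs2 : ∀ a, B₁ a ≤ ∑ a, |B₁ a| := fun a => (le_abs_self _).trans
    (Finset.single_le_sum (f := fun a => |B₁ a|) (fun _ _ => abs_nonneg _) (Finset.mem_univ a))
  have hs3 : ∀ a, B₂ a ≤ ∑ a, |B₂ a| := fun a => (le_abs_self _).trans
    (Finset.single_le_sum (f := fun a => |B₂ a|) (fun _ _ => abs_nonneg _) (Finset.mem_univ a))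
  have hp2 : 0 ≤ ∑ a, |B₁ a| := by positivity
  have hp3 : 0 ≤ ∑ a, |B₂ a| := by positivity
  -- The cutoffs are dilations `f (s n • x)` of one bump; each derivative gains a factor `s n ≤ 1`,
  -- so the bounds are uniform in `n`.
  set s : ℕ → ℝ := fun n => ((n : ℝ) + 1)⁻¹ with hs
  have hs0 : ∀ n, 0 < s n := fun n => by positivity
  have hs1 : ∀ n, s n ≤ 1 := fun n => inv_le_one_of_one_le₀ (by
    linarith [(Nat.cast_nonneg n : (0 : ℝ) ≤ n)])
  have hd1 : ∀ n a, pderiv a (fun x => f (s n • x)) = fun x => s n * pderiv a f (s n • x) :=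
    fun n a => pderiv_comp_smul (hf.differentiable (by simp)) _ _
  have hd2 : ∀ n a, pderiv a (pderiv a (fun x => f (s n • x)))
      = fun x => s n * (s n * pderiv a (pderiv a f) (s n • x)) := by
    intro n a
    have hdf : Differentiable ℝ (pderiv a f) := (contDiff_pderiv hf a).differentiable (by simp)
    have hsc : ContDiff ℝ ∞ fun x : EuclideanSpace ℝ (Fin k) => s n • x :=
      contDiff_const_smul (s n)
    have hdc : Differentiable ℝ fun x => pderiv a f (s n • x) :=
      ((contDiff_pderiv hf a).comp hsc).differentiable (by simp)
    rw [hd1]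
    ext1 x
    rw [pderiv_mul (by fun_prop) (hdc x), pderiv_const, pderiv_comp_smul hdf]
    simp
  refine ⟨fun n x => f (s n • x), 1 + ∑ a, |B₁ a| + ∑ a, |B₂ a|, fun n => ?_, fun n => ?_,
    fun n x => ?_, fun n a x => ?_, fun n a x => ?_, fun x => ?_⟩
  · exact hf.comp (contDiff_const_smul (s n))
  · exact hfc.comp_homeomorph (Homeomorph.smulOfNeZero (s n) (hs0 n).ne')
  · have h1 := f.le_one (x := s n • x)
    have h2 := f.nonneg (x := s n • x)
    rw [abs_le]
    constructor <;> linarith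
  · rw [hd1, abs_mul, abs_of_pos (hs0 n)]
    have h1 : |pderiv a f (s n • x)| ≤ B₁ a := hB₁ a _
    calc s n * |pderiv a f (s n • x)| ≤ 1 * B₁ a := by gcongr; exact hs1 n
      _ ≤ _ := by linarith [hs2 a]
  · rw [hd2, abs_mul, abs_mul, abs_of_pos (hs0 n)]
    have h1 : |pderiv a (pderiv a f) (s n • x)| ≤ B₂ a := hB₂ a _
    have h2 : 0 ≤ B₂ a := (abs_nonneg _).trans h1
    have := hs0 n
    calc s n * (s n * |pderiv a (pderiv a f) (s n • x)|) ≤ 1 * (1 * B₂ a) := by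
          gcongr <;> exact hs1 n
      _ ≤ _ := by linarith [hs3 a]
  · have hlim : Tendsto (fun n => s n * ‖x‖) atTop (𝓝 0) := by
      have : Tendsto s atTop (𝓝 0) := by
        simpa [hs, one_div] using tendsto_one_div_add_atTop_nhds_zero_nat (𝕜 := ℝ)
      simpa using this.mul_const ‖x‖
    filter_upwards [hlim.eventually (gt_mem_nhds one_pos)] with n hn
    have hopen : ∀ᶠ y in 𝓝 x, s n * ‖y‖ < 1 :=
      (continuous_const.mul continuous_norm).continuousAt.eventually (gt_mem_nhds hn)
    filter_upwards [hopen] with y hy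
    refine f.one_of_mem_closedBall ?_
    rw [Metric.mem_closedBall, dist_zero_right, norm_smul, Real.norm_of_nonneg (hs0 n).le]
    exact hy.le

theorem memLp_smul_of_bounded {h : EuclideanSpace ℝ (Fin k) → EuclideanSpace ℝ (Fin d)}
    (hh : MemLp h 2) {c : EuclideanSpace ℝ (Fin k) → ℝ} (hc : Continuous c) {B : ℝ}
    (hB : ∀ x, |c x| ≤ B) : MemLp (fun x => c x • h x) 2 :=
  hh.of_le_mul (c := B) (hc.aestronglyMeasurable.smul hh.1) (Eventually.of_forall fun x => by
    rw [norm_smul]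
    gcongr
    exact hB x)

/-- An element of `H²` with `Mu ∈ L²` belongs to the domain of the closure. -/
theorem mem_closure_of_memH2 (hM : ∀ i j, ContDiff ℝ 2 (fun x => M x i j)) {u : L2Field k d}
    (hu : MemH2 u) (hMu : MemLp (mulField M u) 2) :
    ∃ f : L2Field k d, (u, f) ∈ (schrodingerGraph M).topologicalClosure := by
  obtain ⟨hu2, v, w, hv, hw⟩ := hu
  set g : EuclideanSpace ℝ (Fin k) → EuclideanSpace ℝ (Fin d) := fun x => ∑ a, w a a x with hgdef
  have hg : MemLp g 2 := memLp_finsetSum _ fun a _ => (hw a a).1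
  have hwl : HasWeakLaplacian u g := hasWeakLaplacian_sum hu2 (fun a => (hw a a).1)
    (fun a => (hv a).2) fun a => (hw a a).2
  obtain ⟨χ, B, hχ, hχc, hB0, hB1, hB2, hev⟩ := exists_cutoff_sequence k
  have hB : 0 ≤ B := (abs_nonneg _).trans (hB0 0 0)
  have hχB : ∀ n x, |χ n x| ≤ B + 1 := fun n x => by
    have h1 := hB0 n x
    rw [abs_le] at h1 ⊢
    constructor <;> linarith [h1.1, h1.2]
  have hF : MemLp (fun x => -g x + mulField M u x) 2 := hg.neg.add hMu
  have hχ1 : ∀ n a, Continuous (pderiv a (χ n)) := fun n a => (contDiff_pderiv (hχ n) a).continuous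
  have hχ2 : ∀ n a, Continuous (pderiv a (pderiv a (χ n))) := fun n a =>
    (contDiff_pderiv (contDiff_pderiv (hχ n) a) a).continuous
  have m1 : ∀ n, MemLp (fun x => χ n x • u x) 2 := fun n =>
    memLp_smul_of_bounded hu2 (hχ n).continuous (hχB n)
  have hb1' : ∀ n a x, |2 * pderiv a (χ n) x| ≤ 2 * B := fun n a x => by
    rw [abs_mul, abs_two]; gcongr; exact hB1 n a x
  have m2 : ∀ n a, MemLp (fun x => (2 * pderiv a (χ n) x) • v a x) 2 := fun n a =>
    memLp_smul_of_bounded (hv a).1 (continuous_const.mul (hχ1 n a)) (hb1' n a)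
  have m3 : ∀ n a, MemLp (fun x => pderiv a (pderiv a (χ n)) x • u x) 2 := fun n a =>
    memLp_smul_of_bounded hu2 (hχ2 n a) (hB2 n a)
  have m4 : ∀ n, MemLp (fun x => χ n x • g x
      + ∑ a, ((2 * pderiv a (χ n) x) • v a x + pderiv a (pderiv a (χ n)) x • u x)) 2 := fun n =>
    (memLp_smul_of_bounded hg (hχ n).continuous (hχB n)).add
      (memLp_finsetSum _ fun a _ => (m2 n a).add (m3 n a))
  set G := fun n x => χ n x • g x
      + ∑ a, ((2 * pderiv a (χ n) x) • v a x + pderiv a (pderiv a (χ n)) x • u x) with hG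
  -- A scalar cutoff commutes with `M`, so only the Laplacian produces commutator terms and no
  -- growth condition on `M` is needed.
  have hMeq : ∀ n x, mulField M (fun x => χ n x • u x) x = χ n x • mulField M u x := fun n x => by
    rw [mulField_apply, mulField_apply, map_smul]
  have m5 : ∀ n, MemLp (fun x => -G n x + mulField M (fun x => χ n x • u x) x) 2 := fun n => by
    simp_rw [hMeq]
    exact (m4 n).neg.add (memLp_smul_of_bounded hMu (hχ n).continuous (hχB n))
  have hmem : ∀ n, (((m1 n).toLp, (m5 n).toLp) : L2Field k d × L2Field k d)
      ∈ (schrodingerGraph M).topologicalClosure := fun n =>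
    mem_closure_of_hasCompactSupport hM (hχc n).smul_right (m1 n) (m4 n)
      (HasWeakLaplacian.smul hu2 (fun a => (hv a).1) hg hwl (fun a => (hv a).2) (hχ n))
      (m1 n).coeFn_toLp (m5 n).coeFn_toLp
  have hone : ∀ x, ∀ᶠ n in atTop, χ n x - 1 = 0 := fun x => by
    filter_upwards [hev x] with n hn
    rw [hn.self_of_nhds, sub_self]
  refine ⟨hF.toLp, (schrodingerGraph M).isClosed_topologicalClosure.mem_of_tendsto
    (b := atTop) (f := fun n => (((m1 n).toLp, (m5 n).toLp) : L2Field k d × L2Field k d))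
    (Tendsto.prodMk_nhds (tendsto_toLp_of_tendsto_eLpNorm m1 ?_)
      (tendsto_toLp_of_tendsto_eLpNorm m5 ?_)) (Eventually.of_forall hmem)⟩
  · refine (tendsto_eLpNorm_smul_zero hu2 (c := fun n x => χ n x - 1)
      (fun n => (hχ n).continuous.sub continuous_const) hB0 hone).congr fun n => ?_
    simp_rw [sub_smul, one_smul]
  · have t1 := tendsto_eLpNorm_smul_zero hF (c := fun n x => χ n x - 1)
      (fun n => (hχ n).continuous.sub continuous_const) hB0 hone
    have t2 := fun a => tendsto_eLpNorm_smul_zero (hv a).1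
      (c := fun n x => 2 * pderiv a (χ n) x) (fun n => continuous_const.mul (hχ1 n a))
      (fun n x => hb1' n a x) fun x => by
        filter_upwards [hev x] with n hn
        rw [pderiv_congr hn, pderiv_const, mul_zero]
    have t3 := fun a => tendsto_eLpNorm_smul_zero hu2
      (c := fun n x => pderiv a (pderiv a (χ n)) x) (fun n => hχ2 n a)
      (fun n x => hB2 n a x) fun x => by
        filter_upwards [hev x] with n hn
        rw [pderiv_congr (pderiv_eventuallyEq hn), funext (pderiv_const a (1 : ℝ)), pderiv_const]
    -- The error is `(χ n - 1)(-g + M u)` minus the commutator terms. Each has a bounded coefficient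
    -- that eventually vanishes at every point.
    have hle : ∀ n, eLpNorm (fun x => -G n x + mulField M (fun x => χ n x • u x) x
          - (MemLp.toLp _ hF : L2Field k d) x) 2 volume
        ≤ eLpNorm (fun x => (χ n x - 1) • (-g x + mulField M u x)) 2 volume
          + ∑ a, (eLpNorm (fun x => (2 * pderiv a (χ n) x) • v a x) 2 volume
            + eLpNorm (fun x => pderiv a (pderiv a (χ n)) x • u x) 2 volume) := by
      intro n
      have hmF : MemLp (fun x => (χ n x - 1) • (-g x + mulField M u x)) 2 :=
        memLp_smul_of_bounded hF ((hχ n).continuous.sub continuous_const) (hB0 n)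
      have hsum : eLpNorm (fun x => ∑ a, ((2 * pderiv a (χ n) x) • v a x
          + pderiv a (pderiv a (χ n)) x • u x)) 2 volume
          ≤ ∑ a, (eLpNorm (fun x => (2 * pderiv a (χ n) x) • v a x) 2 volume
            + eLpNorm (fun x => pderiv a (pderiv a (χ n)) x • u x) 2 volume) := by
        have := eLpNorm_sum_le (s := Finset.univ) (μ := volume) (p := 2)
          (f := fun a x => (2 * pderiv a (χ n) x) • v a x + pderiv a (pderiv a (χ n)) x • u x)
          (fun a _ => ((m2 n a).add (m3 n a)).1) (by norm_num)
        refine le_trans (le_of_eq ?_) (this.trans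
          (Finset.sum_le_sum fun a _ => eLpNorm_add_le (m2 n a).1 (m3 n a).1 (by norm_num)))
        congr 1
        ext1 x
        simp
      have hmS : MemLp (fun x => ∑ a, ((2 * pderiv a (χ n) x) • v a x
          + pderiv a (pderiv a (χ n)) x • u x)) 2 :=
        memLp_finsetSum _ fun a _ => (m2 n a).add (m3 n a)
      refine le_trans (le_of_eq ?_)
        ((eLpNorm_sub_le hmF.1 hmS.1 (by norm_num)).trans (add_le_add le_rfl hsum))
      refine eLpNorm_congr_ae ?_
      filter_upwards [hF.coeFn_toLp] with x hx
      rw [hx, hMeq]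
      simp only [hG, Pi.sub_apply, sub_smul, one_smul, smul_add, smul_neg]
      abel
    refine tendsto_of_tendsto_of_tendsto_of_le_of_le tendsto_const_nhds ?_ (fun _ => zero_le) hle
    have := t1.add (tendsto_finsetSum Finset.univ fun a _ => (t2 a).add (t3 a))
    simpa using this

end Cutoff

/-! ### Closability and the domain for general skew potentials -/

section Domain

variable {k d : ℕ} {M : EuclideanSpace ℝ (Fin k) → Matrix (Fin d) (Fin d) ℝ}

/-- Closability and the domain of the closure for a general skew-symmetric potential. -/
theorem isClosable_and_domain_eq (hM : ∀ i j, ContDiff ℝ 2 (fun x => M x i j))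
    (hskew : ∀ x, (M x)ᵀ = -M x) {C R : ℝ} (hC : 0 < C) (hR : 0 < R)
    (hder : ∀ x, R ≤ ‖x‖ → ∀ (i j : Fin d) (n : ℕ), 1 ≤ n → n ≤ 2 → ∀ a : Fin n → Fin k,
      ENNReal.ofReal |partialDeriv a (fun y => M y i j) x|
        ≤ ENNReal.ofReal C * minNonzeroEigenvalueModulus (M x))
    {m : ℕ} (hm : ∀ x, R ≤ ‖x‖ → dimKer (M x) = m) :
    (schrodingerOp M).IsClosable ∧
      ((closedSchrodingerOp M).domain : Set (L2Field k d)) =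
        {u : L2Field k d | MemH2 u ∧ MemLp (mulField M u) 2} := by
  obtain ⟨K, hK, hbd⟩ := exists_apriori_bound hM hskew hC hder hm hR
  have hex := fun q => exists_of_mem_closure_graph (q := q) hM hK hbd
  -- If the first component is zero, so are its weak derivatives and `M` applied to it; these
  -- determine the second component.
  have hclos : (schrodingerOp M).IsClosable := by
    refine ⟨(schrodingerGraph M).topologicalClosure.toLinearPMap, ?_⟩
    rw [schrodingerOp_graph, Submodule.toLinearPMap_graph_eq]
    rintro q hq h0
    obtain ⟨v, w, t, hv, hw, ht, hq2⟩ := hex q hq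
    have hq0 : q.1 =ᵐ[volume] 0 := by rw [h0]; exact Lp.coeFn_zero _ _ _
    have hv0 := fun a => (hv a).ae_eq_zero hq0 (Lp.memLp _)
    have hw0 : ∀ a, w a a = 0 := fun a =>
      (Lp.eq_zero_iff_ae_eq_zero).2 ((hw a a).ae_eq_zero (hv0 a) (Lp.memLp _))
    have ht0 : t = 0 := by
      rw [Lp.eq_zero_iff_ae_eq_zero]
      filter_upwards [ht, hq0] with x hx h0
      rw [hx, mulField_apply, h0, Pi.zero_apply, map_zero]
    rw [hq2, ht0]
    simp [hw0]
  refine ⟨hclos, Set.ext fun u => ?_⟩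
  have hgraph : (closedSchrodingerOp M).graph = (schrodingerGraph M).topologicalClosure := by
    rw [closedSchrodingerOp, ← hclos.graph_closure_eq_closure_graph, schrodingerOp_graph]
  rw [SetLike.mem_coe, LinearPMap.mem_domain_iff, hgraph]
  constructor
  · rintro ⟨f, hf⟩
    obtain ⟨v, w, t, hv, hw, ht, -⟩ := hex _ hf
    exact ⟨⟨Lp.memLp u, fun a => v a, fun a b => w a b, fun a => ⟨Lp.memLp _, hv a⟩,
      fun a b => ⟨Lp.memLp _, hw a b⟩⟩, (memLp_congr_ae ht).1 (Lp.memLp t)⟩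
  · rintro ⟨h1, h2⟩
    exact mem_closure_of_memH2 hM h1 h2

end Domain

/-! ### The cross-product potential in dimension three -/

section CrossProduct

theorem crossMatrix_eq (b : EuclideanSpace ℝ (Fin 3)) :
    crossMatrix b = !![0, -b 2, b 1; b 2, 0, -b 0; -b 1, b 0, 0] := by
  ext i j
  fin_cases i <;> fin_cases j <;>
    simp [crossMatrix, LinearMap.toMatrix'_apply, cross_apply]

theorem crossMatrix_transpose (b : EuclideanSpace ℝ (Fin 3)) :
    (crossMatrix b)ᵀ = -crossMatrix b := by
  rw [crossMatrix_eq]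
  ext i j
  fin_cases i <;> fin_cases j <;> simp

/-- Every entry is zero or a component of `b` up to sign, so regularity and derivative bounds pass
from `b` to the matrix with the same constant. -/
theorem crossMatrix_apply_cases (i j : Fin 3) :
    (∀ b, crossMatrix b i j = 0) ∨ (∃ l, ∀ b, crossMatrix b i j = b l) ∨
      ∃ l, ∀ b, crossMatrix b i j = -b l := by
  simp_rw [crossMatrix_eq]
  fin_cases i <;> fin_cases j
  · exact .inl fun b => rfl
  · exact .inr (.inr ⟨2, fun b => rfl⟩)
  · exact .inr (.inl ⟨1, fun b => rfl⟩)
  · exact .inr (.inl ⟨2, fun b => rfl⟩)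
  · exact .inl fun b => rfl
  · exact .inr (.inr ⟨0, fun b => rfl⟩)
  · exact .inr (.inr ⟨1, fun b => rfl⟩)
  · exact .inr (.inl ⟨0, fun b => rfl⟩)
  · exact .inl fun b => rfl

/-- The characteristic polynomial is `z (z² + |b|²)`, so each nonzero eigenvalue has modulus `|b|`.
-/
theorem norm_le_minNonzeroEigenvalueModulus_crossMatrix (b : EuclideanSpace ℝ (Fin 3)) :
    ENNReal.ofReal ‖b‖ ≤ minNonzeroEigenvalueModulus (crossMatrix b) := by
  refine le_iInf₂ fun z hz => ?_
  have hz0 : z ≠ 0 := hz.2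
  have h := hz.1
  rw [spectrum.mem_iff, Matrix.isUnit_iff_isUnit_det, isUnit_iff_ne_zero, not_not,
    crossMatrix_eq, Matrix.det_fin_three] at h
  have hn : ‖b‖ ^ 2 = b 0 ^ 2 + b 1 ^ 2 + b 2 ^ 2 := by
    rw [EuclideanSpace.real_norm_sq_eq, Fin.sum_univ_three]
  have hsq : z ^ 2 = -((‖b‖ : ℂ) ^ 2) := by
    have h' : z * (z ^ 2 + (‖b‖ : ℂ) ^ 2) = 0 := by
      rw [← h]
      norm_cast
      rw [hn]
      simp [Matrix.algebraMap_matrix_apply]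
      ring
    linear_combination (mul_eq_zero.1 h').resolve_left hz0
  have : ‖z‖ ^ 2 = ‖b‖ ^ 2 := by
    rw [← norm_pow, hsq, norm_neg, norm_pow, Complex.norm_real, norm_norm]
  rw [← ofReal_norm, ← (sq_eq_sq₀ (norm_nonneg z) (norm_nonneg b)).1 this]

/-- From `b × (b × w) = (b · w) b - |b|² w`, a vector `w` with `b × w = 0` is a multiple of `b`. -/
theorem dimKer_crossMatrix {b : EuclideanSpace ℝ (Fin 3)} (hb : b ≠ 0) :
    dimKer (crossMatrix b) = 1 := by
  have hb' : b.ofLp ≠ 0 := fun h => hb (by ext i; exact congrFun h i)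
  have hker : LinearMap.ker (Matrix.toLin' (crossMatrix b)) = Submodule.span ℝ {b.ofLp} := by
    ext w
    rw [LinearMap.mem_ker, Matrix.toLin'_apply, crossMatrix_mulVec, Submodule.mem_span_singleton]
    constructor
    · intro h
      have hn : b.ofLp ⬝ᵥ b.ofLp ≠ 0 := dotProduct_self_eq_zero.not.2 hb'
      refine ⟨(b.ofLp ⬝ᵥ w) / (b.ofLp ⬝ᵥ b.ofLp), ?_⟩
      have h2 : b.ofLp ⨯₃ (b.ofLp ⨯₃ w) = 0 := by rw [h, map_zero]
      have h3 : (b.ofLp ⬝ᵥ w) • b.ofLp = (b.ofLp ⬝ᵥ b.ofLp) • w := by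
        rw [← sub_eq_zero, ← h2]
        ext i
        fin_cases i <;> simp [cross_apply, dotProduct, Fin.sum_univ_three] <;> ring
      rw [div_eq_inv_mul, mul_smul, h3, smul_smul, inv_mul_cancel₀ hn, one_smul]
    · rintro ⟨c, rfl⟩
      rw [map_smul, cross_self, smul_zero]
  rw [dimKer, hker, finrank_span_singleton hb']

theorem abs_partialDeriv_neg {k n : ℕ} (a : Fin n → Fin k) (f : EuclideanSpace ℝ (Fin k) → ℝ)
    (x : EuclideanSpace ℝ (Fin k)) :
    |partialDeriv a (fun y => -f y) x| = |partialDeriv a f x| := by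
  have h : iteratedFDeriv ℝ n (fun y => -f y) x = -iteratedFDeriv ℝ n f x :=
    iteratedFDeriv_neg_apply
  rw [partialDeriv, h, _root_.neg_apply, abs_neg]
  rfl

/-- Closability and the domain of the closure for the potential `u ↦ b × u`. -/
theorem isClosable_and_domain_eq_cross {b : EuclideanSpace ℝ (Fin 3) → EuclideanSpace ℝ (Fin 3)}
    (hb : ContDiff ℝ 2 b) {C R : ℝ} (hC : 0 < C) (hR : 0 < R)
    (h : ∀ x : EuclideanSpace ℝ (Fin 3), R ≤ ‖x‖ → b x ≠ 0 ∧
      ∀ (j : Fin 3) (n : ℕ), 1 ≤ n → n ≤ 2 → ∀ a : Fin n → Fin 3,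
        |partialDeriv a (fun y => b y j) x| ≤ C * ‖b x‖) :
    (schrodingerOp (fun x => crossMatrix (b x))).IsClosable ∧
      ((closedSchrodingerOp (fun x => crossMatrix (b x))).domain : Set (L2Field 3 3)) =
        {u : L2Field 3 3 | MemH2 u ∧
          MemLp (fun x => WithLp.toLp 2 ((b x).ofLp ⨯₃ (u x).ofLp)
            : EuclideanSpace ℝ (Fin 3) → EuclideanSpace ℝ (Fin 3)) 2} := by
  have hbj : ∀ j, ContDiff ℝ 2 fun x => b x j := fun j => (contDiff_euclidean.1 hb) j
  have hmul : ∀ u : EuclideanSpace ℝ (Fin 3) → EuclideanSpace ℝ (Fin 3),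
      mulField (fun x => crossMatrix (b x)) u
        = fun x => WithLp.toLp 2 ((b x).ofLp ⨯₃ (u x).ofLp) := fun u => by
    ext1 x
    rw [mulField, crossMatrix_mulVec]
  simp_rw [← hmul]
  refine isClosable_and_domain_eq (C := C) (R := R) (m := 1) (fun i j => ?_)
    (fun x => crossMatrix_transpose _) hC hR (fun x hx i j n h1 h2 a => ?_)
    fun x hx => dimKer_crossMatrix (h x hx).1
  · obtain hz | ⟨l, hl⟩ | ⟨l, hl⟩ := crossMatrix_apply_cases i j
    · simp_rw [hz]; exact contDiff_const
    · simp_rw [hl]; exact hbj l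
    · simp_rw [hl]; exact (hbj l).neg
  · have hle : |partialDeriv a (fun y => crossMatrix (b y) i j) x| ≤ C * ‖b x‖ := by
      obtain hz | ⟨l, hl⟩ | ⟨l, hl⟩ := crossMatrix_apply_cases i j
      · simp_rw [hz]
        rw [partialDeriv, iteratedFDeriv_const_of_ne (by omega)]
        simpa using by positivity
      · simp_rw [hl]; exact (h x hx).2 l n h1 h2 a
      · simp_rw [hl, abs_partialDeriv_neg]; exact (h x hx).2 l n h1 h2 a
    calc _ ≤ ENNReal.ofReal (C * ‖b x‖) := ENNReal.ofReal_le_ofReal hle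
      _ = ENNReal.ofReal C * ENNReal.ofReal ‖b x‖ := ENNReal.ofReal_mul hC.le
      _ ≤ _ := by gcongr; exact norm_le_minNonzeroEigenvalueModulus_crossMatrix _

end CrossProduct

theorem mainTheorem7 :
    (∀ (k d : ℕ) (M : EuclideanSpace ℝ (Fin k) → Matrix (Fin d) (Fin d) ℝ),
      (∀ i j, ContDiff ℝ 2 (fun x => M x i j)) →
      (∀ x, (M x)ᵀ = -M x) →
      (∃ C R : ℝ, 0 < C ∧ 0 < R ∧
        (∀ x : EuclideanSpace ℝ (Fin k), R ≤ ‖x‖ → ∀ (i j : Fin d) (n : ℕ), 1 ≤ n → n ≤ 2 →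
          ∀ a : Fin n → Fin k,
            ENNReal.ofReal |partialDeriv a (fun y => M y i j) x|
              ≤ ENNReal.ofReal C * minNonzeroEigenvalueModulus (M x)) ∧
        (∃ m : ℕ, ∀ x : EuclideanSpace ℝ (Fin k), R ≤ ‖x‖ → dimKer (M x) = m)) →
      (schrodingerOp M).IsClosable ∧
      ((closedSchrodingerOp M).domain : Set (L2Field k d)) =
        {u : L2Field k d | MemH2 u ∧ MemLp (mulField M u) 2}) ∧
    (∀ b : EuclideanSpace ℝ (Fin 3) → EuclideanSpace ℝ (Fin 3),
      ContDiff ℝ 2 b →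
      (∃ C R : ℝ, 0 < C ∧ 0 < R ∧
        ∀ x : EuclideanSpace ℝ (Fin 3), R ≤ ‖x‖ → b x ≠ 0 ∧
          ∀ (j : Fin 3) (n : ℕ), 1 ≤ n → n ≤ 2 → ∀ a : Fin n → Fin 3,
            |partialDeriv a (fun y => b y j) x| ≤ C * ‖b x‖) →
      (schrodingerOp (fun x => crossMatrix (b x))).IsClosable ∧
      ((closedSchrodingerOp (fun x => crossMatrix (b x))).domain : Set (L2Field 3 3)) =
        {u : L2Field 3 3 | MemH2 u ∧
          MemLp (fun x => WithLp.toLp 2 ((b x).ofLp ⨯₃ (u x).ofLp)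
            : EuclideanSpace ℝ (Fin 3) → EuclideanSpace ℝ (Fin 3)) 2}) := by
  refine ⟨?_, ?_⟩
  · rintro k d M hM hskew ⟨C, R, hC, hR, hder, m, hm⟩
    exact isClosable_and_domain_eq hM hskew hC hR hder hm
  · rintro b hb ⟨C, R, hC, hR, h⟩
    exact isClosable_and_domain_eq_cross hb hC hR h
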